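/- Let $(A_i,\phi_i)_{i\in\mathbb N}$ be an inductive sequence of unital stably finite C$^*$-algebras with unital (not necessarily injective) $*$-homomorphisms $\phi_i:A_i\to A_{i+1}$, and let $A=\lim_{i\to\infty}(A_i,\phi_i)$ be its C$^*$-algebraic limit. Suppose that $A$ is simple and that $$\liminf_{i\to\infty}\ \mathrm{rc}(A_i)=0 .$$ Then $A$ (which is again unital and stably finite) has strict comparison of positive elements. Here, for a unital C$^*$-algebra $B$: $B$ is stably finite if $v^*v=1$ implies $vv^*=1$ for all $n$ and all $v\in \mathrm M_n(B)$. Write $\mathrm M_\infty(B)=\bigcup_n \mathrm M_n(B)$ (with embeddings $a\mapsto a\oplus 0$), and for positive $a,b\in \mathrm M_\infty(B)$ write $a\precsim b$ (Cuntz subequivalence) if there are $v_k\in \mathrm M_\infty(B)$ with $\|v_kbv_k^*-a\|\to 0$. A quasitrace on a C$^*$-algebra $D$ is a function $\tau:D\to\mathbb C$ with $0\le \tau(x^*x)=\tau(xx^*)$ for all $x\in D$, which is linear on commutative $*$-subalgebras and satisfies $\tau(a+ib)=\tau(a)+i\tau(b)$ for self-adjoint $a,b$. $\mathrm{QT}(B)$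 is the set of normalised 2-quasitraces on $B$, i.e. the quasitraces $\tau$ on $B$ with $\tau(1)=1$ for which there is a quasitrace $\tau_2$ on $\mathrm M_2(B)$ with $\tau_2(x\otimes e_{11})=\tau(x)$ for all $x\in B$; such a $\tau$ extends uniquely to $\mathrm M_\infty(B)$ so that its restriction to each $\mathrm M_n(B)$ is a quasitrace. $\mathrm{LDF}(B)$ is the set of lower semicontinuous dimension functions $d_\tau$, $\tau\in\mathrm{QT}(B)$, where $d_\tau(a)=\lim_{k\to\infty}\tau(a^{1/k})$ for positive $a\in\mathrm M_\infty(B)$. For $r\ge 0$, $B$ has $r$-strict comparison if, for all positive $a,b\in \mathrm M_\infty(B)$, $a\precsim b$ whenever $d(a)+r<d(b)$ for all $d\in\mathrm{LDF}(B)$. The radius of comparison $\mathrm{rc}(B)\in[0,\infty]$ is the infimum of the real numbers $r\ge 0$ such that $B$ has $r$-strict comparison, and $\infty$ if there are none. $B$ has strict comparison of positive elements if, for all positive $a,b\in \mathrm M_\infty(B)$, $a\precsim b$ whenever $d(a)<d(b)$ for all $d\in\mathrm{LDF}(B)$. -/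

import Mathlib

open Filter Topology
open scoped ComplexOrder ENNReal NNReal

namespace CuntzComparison

noncomputable section

/-- The matrix algebra `M_n(A)`, with its C⋆-norm and its usual order. -/
abbrev Mat (n : ℕ) (A : Type*) : Type _ := CStarMatrix (Fin n) (Fin n) A

/-- A unital C⋆-algebra is stably finite if every isometry in every `M_n(A)` is a unitary. -/
def IsStablyFinite (A : Type*) [CStarAlgebra A] : Prop :=
  ∀ (n : ℕ) (v : Mat n A), star v * v = 1 → v * star v = 1

/-- A C⋆-algebra is simple if it is nonzero and has no closed two-sided ideals besides
`0` and itself. -/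
def IsSimple (A : Type*) [CStarAlgebra A] : Prop :=
  Nontrivial A ∧ ∀ I : TwoSidedIdeal A, IsClosed (I : Set A) → I = ⊥ ∨ I = ⊤

section MatrixAlgebras

variable {A : Type*}

/-- The upper left corner embedding `a ↦ a ⊕ 0` of `M_n(A)` into `M_m(A)`; it is only meant to be
used for `n ≤ m`. -/
def pad [Zero A] {n : ℕ} (m : ℕ) (a : Mat n A) : Mat m A :=
  CStarMatrix.ofMatrix fun i j =>
    if h : (i : ℕ) < n ∧ (j : ℕ) < n then a ⟨i, h.1⟩ ⟨j, h.2⟩ else 0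

/-- The identification of `A` with `M_1(A)`. -/
def single (x : A) : Mat 1 A := CStarMatrix.ofMatrix fun _ _ => x

end MatrixAlgebras

/-- Positive elements of `M_∞(A) = ⋃ M_n(A)`, each given by a representative in some `M_n(A)`. -/
abbrev MInfPos (A : Type*) [CStarAlgebra A] [PartialOrder A] [StarOrderedRing A] : Type _ :=
  Σ n : ℕ, {a : Mat n A // 0 ≤ a}

/-- Cuntz subequivalence `a ≾ b` in `M_∞(A)₊`: there are `v_k ∈ M_∞(A)` with
`‖v_k b v_k⋆ - a‖ → 0`. The element `v_k` lies in `M_{N k}(A)`, with `N k` so large that this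
algebra contains `a` and `b`. -/
def CuntzLE {A : Type*} [CStarAlgebra A] [PartialOrder A] [StarOrderedRing A]
    (a b : MInfPos A) : Prop :=
  ∃ (N : ℕ → ℕ) (v : ∀ k, Mat (N k) A),
    (∀ k, a.1 ≤ N k ∧ b.1 ≤ N k) ∧
    Tendsto (fun k => ‖v k * pad (N k) b.2.1 * star (v k) - pad (N k) a.2.1‖) atTop (𝓝 0)

/-- A (1-)quasitrace on a unital C⋆-algebra: it satisfies `τ(x⋆x) = τ(xx⋆) ≥ 0`, is linear on
commutative ⋆-subalgebras, and `τ(a + ib) = τ(a) + iτ(b)` for self-adjoint `a`, `b`. -/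
structure IsQuasitrace {B : Type*} [CStarAlgebra B] (τ : B → ℂ) : Prop where
  nonneg : ∀ x : B, 0 ≤ τ (star x * x)
  tracial : ∀ x : B, τ (star x * x) = τ (x * star x)
  map_add : ∀ S : NonUnitalStarSubalgebra ℂ B, (∀ x ∈ S, ∀ y ∈ S, x * y = y * x) →
    ∀ x ∈ S, ∀ y ∈ S, τ (x + y) = τ x + τ y
  map_smul : ∀ S : NonUnitalStarSubalgebra ℂ B, (∀ x ∈ S, ∀ y ∈ S, x * y = y * x) →
    ∀ (c : ℂ), ∀ x ∈ S, τ (c • x) = c * τ x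
  map_add_I_smul : ∀ a b : B, IsSelfAdjoint a → IsSelfAdjoint b →
    τ (a + Complex.I • b) = τ a + Complex.I * τ b

/-- The positive root `a^{1/k}` of a positive element, for `k ≥ 1`. -/
def posRoot {B : Type*} [CStarAlgebra B] [PartialOrder B] [StarOrderedRing B] (a : B) (k : ℕ) : B :=
  a ^ (1 / (k : ℝ))

section Quasitraces

variable (A : Type*) [CStarAlgebra A] [PartialOrder A] [StarOrderedRing A]

/-- `QT(A)`: normalised 2-quasitraces on `A`, i.e. quasitraces `τ` with `τ(1) = 1` such that there
is a quasitrace `τ₂` on `M_2(A)` with `τ₂(x ⊗ e₁₁) = τ(x)`. -/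
def QT : Set (A → ℂ) :=
  {τ | IsQuasitrace τ ∧ τ 1 = 1 ∧
    ∃ τ₂ : Mat 2 A → ℂ, IsQuasitrace τ₂ ∧ ∀ x : A, τ₂ (pad 2 (single x)) = τ x}

variable {A}

/-- `T` is the extension of `τ` to a quasitrace on `M_∞(A)`: a family of quasitraces on the `M_n(A)`
that is compatible with the corner embeddings and agrees with `τ` on `A = M_1(A)`. (Every
2-quasitrace has exactly one such extension.) -/
structure IsMatrixExtension (τ : A → ℂ) (T : ∀ n, Mat n A → ℂ) : Prop where
  isQuasitrace : ∀ n, IsQuasitrace (T n)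
  map_single : ∀ x : A, T 1 (single x) = τ x
  map_pad : ∀ (n m : ℕ), n ≤ m → ∀ a : Mat n A, T m (pad m a) = T n a

variable (A)

/-- `LDF(A)`: the lower semicontinuous dimension functions `d_τ`, `τ ∈ QT(A)`, where
`d_τ(a) = lim_k τ(a^{1/k})` for `a ∈ M_∞(A)₊`, the 2-quasitrace `τ` being extended
to `M_∞(A)`. -/
def LDF : Set (MInfPos A → ℝ) :=
  {d | ∃ τ ∈ QT A, ∃ T : ∀ n, Mat n A → ℂ, IsMatrixExtension τ T ∧
    ∀ a : MInfPos A,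
      Tendsto (fun k : ℕ => T a.1 (posRoot a.2.1 k)) atTop (𝓝 ((d a : ℝ) : ℂ))}

/-- `r`-strict comparison. -/
def HasRStrictComparison (r : ℝ≥0) : Prop :=
  ∀ a b : MInfPos A, (∀ d ∈ LDF A, d a + (r : ℝ) < d b) → CuntzLE a b

/-- Strict comparison of positive elements. -/
def HasStrictComparison : Prop :=
  ∀ a b : MInfPos A, (∀ d ∈ LDF A, d a < d b) → CuntzLE a b

/-- The radius of comparison: the infimum, in `[0, ∞]`, of the real `r ≥ 0` such that `A` has
`r`-strict comparison (`∞` if there are none). -/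
def rc : ℝ≥0∞ := ⨅ (r : ℝ≥0) (_ : HasRStrictComparison A r), (r : ℝ≥0∞)

end Quasitraces

section InductiveLimits

variable {A : ℕ → Type*} [∀ i, CStarAlgebra (A i)]

/-- The composed connecting map `φ_{i,i+k} : A_i → A_{i+k}`. -/
def connect (φ : ∀ i, A i →⋆ₐ[ℂ] A (i + 1)) (i : ℕ) : ∀ k : ℕ, A i →⋆ₐ[ℂ] A (i + k)
  | 0 => StarAlgHom.id ℂ (A i)
  | k + 1 => (φ (i + k)).comp (connect φ i k)

/-- `L`, with the canonical maps `ψ i = φ_{i,∞} : A_i → L`, is the C⋆-algebraic limit of the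
inductive sequence `(A_i, φ_i)`: the completion of the algebraic limit `⋃ ψ_i(A_i)` in the
C⋆-norm `‖ψ_i(x)‖ = lim_j ‖φ_{i,j}(x)‖`. The maps need not be injective. -/
structure IsInductiveLimit (φ : ∀ i, A i →⋆ₐ[ℂ] A (i + 1))
    {L : Type*} [CStarAlgebra L] (ψ : ∀ i, A i →⋆ₐ[ℂ] L) : Prop where
  comp_eq : ∀ i, (ψ (i + 1)).comp (φ i) = ψ i
  tendsto_norm : ∀ (i : ℕ) (x : A i),
    Tendsto (fun k => ‖connect φ i k x‖) atTop (𝓝 ‖ψ i x‖)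
  dense : Dense (⋃ i, Set.range (ψ i))

end InductiveLimits

end

end CuntzComparison

/-!
The elements of the limit `L` are handled through *asymptotic representatives* (`IsAsympRep`): a
sequence `x j` in the `A j` represents `a` in `L` if it is within `ε` of a coherent sequence whose
limit is within `ε` of `a`, for every `ε > 0`. Representatives are compatible with the algebraic
operations, with matrices and with the continuous functional calculus, and those of `0` are the null
sequences. Stable finiteness passes to `L`: a representative of an isometry is an approximate
isometry, which is an approximate unitary by polar decomposition (`norm_mul_star_sub_one_le`).

For comparison, suppose that `a` is not Cuntz subequivalent to `b` in `M_∞(L)` although its rank is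
smaller for every dimension function, and let `x j`, `y j` be positive representatives. For some `ε > 0`, no `W b W⋆` is within `4 ε` of `a`. By Rørdam's lemma,
`(x j - ε)₊` is then not Cuntz subequivalent to `(y j - δ)₊` for large `j`
(`eventually_exists_of_cuntzLE`). As `rc (A j) < δ` infinitely often, there are dimension functions on
such `A j` with `d (y j - δ)₊ ≤ d (x j - ε)₊ + δ`. Letting `δ → 0` along a sequence and taking an
ultralimit of the corresponding 2-quasitraces gives a 2-quasitrace on `L` for which the rank of `b`
is at most the rank of `a`, a contradiction. The cut-down by the fixed number `ε` on the side of `a`, and lower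
semicontinuity of the rank on the side of `b`, absorb the failure of dimension functions to commute
with the limit.

The substantial point is that the ultralimit *is* a quasitrace. Linearity on commutative subalgebras
concerns commuting elements of `L`, which need not have commuting representatives, so it cannot be
carried over directly. What can be carried over is the list of properties in `OrderedQuasitrace`:
linearity on each subalgebra generated by one self-adjoint element, the trace identity, monotonicity,
and the inequality `t (a + b) ≤ (1 + s) t a + (1 + s⁻¹) t b` for positive `a`, `b`.
* A quasitrace is monotone (`IsQuasitrace.re_mono`): by the layer cake formula it suffices to compare
  functions of `a` and `b` with values in `[0, 1]`, and these are Cuntz comparable up to a shift by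
  `4` (`exists_factorization_ramp`). The resulting bounded error disappears on rescaling.
* The inequality holds for quasitraces on `M_n` that extend to `M_{2n}`, since there `a + b` is
  equivalent to a two by two matrix dominated by `diag ((1 + s) a, (1 + s⁻¹) b)`
  (`IsQuasitrace.re_add_le_of_corner`).
* These properties imply additivity on commuting self-adjoint elements
  (`OrderedQuasitrace.add_of_commute`): up to an element on which `t` is small, commuting `a` and `b`
  are within distance `1` of linear combinations of the same orthogonal positive elements, and on
  those `t` is additive. The error is bounded independently of `a` and `b`, so it disappears on
  rescaling.
-/

namespace CuntzComparison

/-! ### Factorization and Cuntz comparison in a C⋆-algebra -/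

section CStar

variable {B : Type*} [CStarAlgebra B] [PartialOrder B] [StarOrderedRing B]

lemma mul_sqrt_eq_sqrt {f p : B} (hp : 0 ≤ p) (h : f * p = p) :
    f * CFC.sqrt p = CFC.sqrt p := by
  have hs : star (CFC.sqrt p) = CFC.sqrt p := (CFC.sqrt_nonneg p).isSelfAdjoint.star_eq
  have hz : ((f - 1) * CFC.sqrt p) * star ((f - 1) * CFC.sqrt p) = 0 := by
    rw [star_mul, hs, mul_assoc, ← mul_assoc (CFC.sqrt p), CFC.sqrt_mul_sqrt_self p hp,
      ← mul_assoc, sub_mul, h, one_mul, sub_self, zero_mul]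
  have h0 := (CStarRing.mul_star_self_eq_zero_iff _).1 hz
  rw [sub_mul, one_mul, sub_eq_zero] at h0
  exact h0

/-- If `f` is a unit for `p ≥ 0` and the compression of `p` to the support of `e` is bounded below,
then every `g` supported where `e` is a unit satisfies `g² = w⋆w` with `f` a unit for `ww⋆`. The
element `h = epe + κ(1 - e²)` is invertible and `g = gpeh⁻¹`, so that `g` factors through `p`. -/
lemma exists_factorization {f p e g : B} {κ : ℝ} (hκ : 0 < κ) (hp : 0 ≤ p) (hfp : f * p = p)
    (hg : IsSelfAdjoint g) (hge : g * e = g)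
    (hcomp : κ • (e * e) ≤ e * p * e) :
    ∃ w : B, star w * w = g * g ∧ f * (w * star w) = w * star w := by
  set h : B := e * p * e + κ • (1 - e * e) with hh
  have hle : κ • (1 : B) ≤ h := by
    have : κ • (1 : B) = κ • (e * e) + κ • (1 - e * e) := by rw [← smul_add]; congr 1; abel
    rw [this, hh]
    gcongr
  have hu : IsUnit h := by
    refine CStarAlgebra.isUnit_of_le (κ • (1 : B)) hle ?_
    exact isStrictlyPositive_one.smul hκ
  obtain ⟨u, hu⟩ := hu
  set s := CFC.sqrt p
  have hs : s * s = p := CFC.sqrt_mul_sqrt_self p hp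
  have hss : star s = s := (CFC.sqrt_nonneg p).isSelfAdjoint.star_eq
  set x := g * s
  set y := s * e * (↑u⁻¹ : B)
  have hxy : x * y = g := by
    have h1 : g * h = g * p * e := by
      rw [hh, mul_add, mul_smul_comm, mul_sub, ← mul_assoc g (e * p), ← mul_assoc g e p, hge,
        ← mul_assoc g e e, hge, hge, mul_one, sub_self, smul_zero, add_zero]
    calc x * y = g * (s * s) * e * ↑u⁻¹ := by simp only [x, y, mul_assoc]
      _ = g * h * ↑u⁻¹ := by rw [hs, h1]
      _ = g := by rw [← hu, mul_assoc, Units.mul_inv, mul_one]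
  have hy0 : 0 ≤ y * star y := mul_star_self_nonneg y
  set r := CFC.sqrt (y * star y)
  have hr : r * r = y * star y := CFC.sqrt_mul_sqrt_self _ hy0
  have hrs : star r = r := (CFC.sqrt_nonneg _).isSelfAdjoint.star_eq
  have hfs : f * s = s := mul_sqrt_eq_sqrt hp hfp
  have hfr : f * r = r := by
    refine mul_sqrt_eq_sqrt hy0 ?_
    simp only [y, ← mul_assoc]
    rw [hfs]
  refine ⟨r * star x, ?_, ?_⟩
  · calc star (r * star x) * (r * star x) = x * (r * r) * star x := by
          rw [star_mul, star_star, hrs]; simp only [mul_assoc]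
      _ = (x * y) * star (x * y) := by rw [hr, star_mul x y]; simp only [mul_assoc]
      _ = g * g := by rw [hxy, hg.star_eq]
  · simp only [← mul_assoc]
    rw [hfr]

lemma conj_le_conj_of_isSelfAdjoint {a b e : B} (he : IsSelfAdjoint e) (h : a ≤ b) :
    e * a * e ≤ e * b * e := by
  have := star_left_conjugate_le_conjugate h e
  rwa [he.star_eq] at this

end CStar

/-- The function which is `0` on `(-∞, 0]`, the identity on `[0, 1]` and `1` on `[1, ∞)`. -/
noncomputable def ramp (x : ℝ) : ℝ := max 0 (min 1 x)

lemma continuous_ramp : Continuous ramp := by unfold ramp; fun_prop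
lemma ramp_nonneg (x : ℝ) : 0 ≤ ramp x := le_max_left _ _
lemma ramp_le_one (x : ℝ) : ramp x ≤ 1 := by simp [ramp]
lemma ramp_of_nonpos {x : ℝ} (h : x ≤ 0) : ramp x = 0 := by
  unfold ramp; rw [min_eq_right (by linarith), max_eq_left h]
lemma ramp_of_one_le {x : ℝ} (h : 1 ≤ x) : ramp x = 1 := by simp [ramp, h]
lemma ramp_of_mem {x : ℝ} (h0 : 0 ≤ x) (h1 : x ≤ 1) : ramp x = x := by simp [ramp, h0, h1]
lemma ramp_mono : Monotone ramp := fun x y h => by unfold ramp; gcongr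

@[fun_prop]
lemma Continuous.ramp' {X : Type*} [TopologicalSpace X] {f : X → ℝ} (hf : Continuous f) :
    Continuous fun x => ramp (f x) := continuous_ramp.comp hf

@[fun_prop]
lemma ContinuousOn.ramp' {X : Type*} [TopologicalSpace X] {f : X → ℝ} {s : Set X}
    (hf : ContinuousOn f s) : ContinuousOn (fun x => ramp (f x)) s :=
  continuous_ramp.comp_continuousOn hf

lemma sum_ramp (K : ℕ) {x : ℝ} (hx : 0 ≤ x) (hK : x ≤ K) :
    ∑ k ∈ Finset.range K, ramp (x - k) = x := by
  induction K generalizing x with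
  | zero => simp at hK ⊢; linarith
  | succ K ih =>
    rw [Finset.sum_range_succ]
    rcases le_total x K with h | h
    · rw [ih hx h, ramp_of_nonpos (by linarith), add_zero]
    · push_cast at hK
      rw [ramp_of_mem (by linarith) (by linarith)]
      rw [Finset.sum_congr rfl (g := fun k : ℕ => (1:ℝ))]
      · simp
      · intro k hk
        have : (k:ℝ) + 1 ≤ K := by exact_mod_cast Finset.mem_range.1 hk
        exact ramp_of_one_le (by linarith)

section CStar

variable {B : Type*} [CStarAlgebra B] [PartialOrder B] [StarOrderedRing B]

/-- For `0 ≤ a ≤ b`, a function of `a` supported on `(k + 3, ∞)` is Cuntz below any function of `b`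
equal to `1` on `[k + 1, ∞)`. -/
lemma exists_factorization_ramp {a b : B} (ha : 0 ≤ a) (hab : a ≤ b) {k : ℝ} (hk : 0 ≤ k) :
    ∃ w : B, star w * w = cfc (fun x => ramp (x - (k + 4))) a ∧
      cfc (fun x => ramp (x - k)) b * (w * star w) = w * star w := by
  have hb : 0 ≤ b := ha.trans hab
  have hsa : IsSelfAdjoint a := ha.isSelfAdjoint
  have hsb : IsSelfAdjoint b := hb.isSelfAdjoint
  set C : ℝ := ‖b‖ + 1
  have hC : 0 < C := by positivity
  set e := cfc (fun x => ramp (x - (k + 3))) a with he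
  set g := cfc (fun x => √(ramp (x - (k + 4)))) a with hg
  set p := cfc (fun x => ramp (x - (k + 1))) b with hp
  have hes : IsSelfAdjoint e := cfc_predicate _ _
  have hgs : IsSelfAdjoint g := cfc_predicate _ _
  have hgg : g * g = cfc (fun x => ramp (x - (k + 4))) a := by
    rw [hg, ← cfc_mul _ _ a]
    refine cfc_congr fun x _ => ?_
    exact Real.mul_self_sqrt (ramp_nonneg _)
  rw [← hgg]
  refine exists_factorization (κ := C⁻¹) (p := p) (e := e) (by positivity) ?_ ?_ hgs ?_ ?_
  · exact cfc_nonneg fun x _ => ramp_nonneg _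
  · rw [hp, ← cfc_mul _ _ b]
    refine cfc_congr fun x _ => ?_
    rcases le_total x (k + 1) with h | h
    · simp [ramp_of_nonpos (show x - (k + 1) ≤ 0 by linarith)]
    · simp [ramp_of_one_le (show 1 ≤ x - k by linarith)]
  · rw [hg, he, ← cfc_mul _ _ a]
    refine cfc_congr fun x _ => ?_
    rcases le_total x (k + 4) with h | h
    · simp [ramp_of_nonpos (show x - (k + 4) ≤ 0 by linarith)]
    · simp [ramp_of_one_le (show 1 ≤ x - (k + 3) by linarith)]
  · have h1 : (k + 3) • (e * e) ≤ e * a * e := by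
      have hid : a = cfc (fun x : ℝ => x) a := (cfc_id' ℝ a).symm
      conv_rhs => rw [hid]
      rw [he, ← cfc_mul _ _ a, ← cfc_mul _ _ a, ← cfc_mul _ _ a, ← cfc_smul _ _ a]
      refine cfc_mono fun x _ => ?_
      rcases le_total x (k + 3) with h | h
      · simp [ramp_of_nonpos (show x - (k + 3) ≤ 0 by linarith)]
      · have := ramp_nonneg (x - (k + 3))
        simp only [smul_eq_mul]
        nlinarith [mul_nonneg this this]
    have h2 : b ≤ (k + 2) • (1 : B) + C • p := by
      have hid : cfc (fun x : ℝ => x) b = b := cfc_id' ℝ b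
      have h1 : (1 : B) = cfc (fun _ : ℝ => (1:ℝ)) b := (cfc_const_one ℝ b).symm
      conv_lhs => rw [← hid]
      rw [h1, hp, ← cfc_smul _ _ b, ← cfc_smul _ _ b, ← cfc_add _ _ _]
      refine cfc_mono fun x hx => ?_
      have hxb : x ≤ C := by
        have := spectrum.norm_le_norm_mul_of_mem hx
        have h3 : ‖(1:B)‖ ≤ 1 := by
          rcases subsingleton_or_nontrivial B with h | h
          · simp [Subsingleton.elim (1:B) 0]
          · simp
        have : x ≤ ‖b‖ := (le_abs_self x).trans (this.trans (by
          nlinarith [norm_nonneg b]))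
        simp only [C]; linarith
      simp only [smul_eq_mul, mul_one]
      rcases le_total x (k + 2) with h | h
      · have := ramp_nonneg (x - (k + 1))
        nlinarith
      · rw [ramp_of_one_le (by linarith)]; linarith
    have h3 := h1.trans ((conj_le_conj_of_isSelfAdjoint hes hab).trans
      (conj_le_conj_of_isSelfAdjoint hes h2))
    have h4 : e * ((k + 2) • (1 : B) + C • p) * e = (k + 2) • (e * e) + C • (e * p * e) := by
      simp only [mul_add, add_mul, mul_smul_comm, smul_mul_assoc, mul_one]
    rw [h4, show k + 3 = (k + 2) + 1 by ring, add_smul, one_smul] at h3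
    have h5 : e * e ≤ C • (e * p * e) := le_of_add_le_add_left h3
    have h6 := smul_le_smul_of_nonneg_left h5 (inv_nonneg.2 hC.le)
    rwa [smul_smul, inv_mul_cancel₀ hC.ne', one_smul] at h6

end CStar

/-! ### Order properties of quasitraces -/

namespace IsQuasitrace

variable {B : Type*} [CStarAlgebra B] {T : B → ℂ}

lemma adjoin_comm {a b : B} (ha : IsSelfAdjoint a) (hb : IsSelfAdjoint b)
    (hab : Commute a b) : ∀ x ∈ NonUnitalStarAlgebra.adjoin ℂ {a, b},
      ∀ y ∈ NonUnitalStarAlgebra.adjoin ℂ {a, b}, x * y = y * x := by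
  intro x hx y hy
  have := NonUnitalStarAlgebra.isMulCommutative_adjoin ℂ (s := {a, b})
    (by
      rintro c (rfl | rfl) d (rfl | rfl)
      exacts [rfl, hab.eq, hab.eq.symm, rfl])
    (by
      rintro c (rfl | rfl) d (rfl | rfl) <;> rw [(by assumption : IsSelfAdjoint _).star_eq]
      exacts [hab.eq, hab.eq.symm])
  exact congrArg Subtype.val
    (mul_comm' (⟨x, hx⟩ : NonUnitalStarAlgebra.adjoin ℂ {a, b}) ⟨y, hy⟩)

lemma add_of_commute (h : IsQuasitrace T) {a b : B} (ha : IsSelfAdjoint a) (hb : IsSelfAdjoint b)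
    (hab : Commute a b) : T (a + b) = T a + T b :=
  h.map_add _ (adjoin_comm ha hb hab) a
    (NonUnitalStarAlgebra.subset_adjoin ℂ _ (by simp)) b
    (NonUnitalStarAlgebra.subset_adjoin ℂ _ (by simp))

lemma smul_of_isSelfAdjoint (h : IsQuasitrace T) {a : B} (ha : IsSelfAdjoint a) (c : ℝ) :
    T (c • a) = c * T a := by
  have := h.map_smul _ (adjoin_comm ha ha (Commute.refl a)) c a
    (NonUnitalStarAlgebra.subset_adjoin ℂ _ (by simp))
  rwa [Complex.coe_smul] at this

lemma zero (h : IsQuasitrace T) : T 0 = 0 := by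
  simpa using h.smul_of_isSelfAdjoint (IsSelfAdjoint.zero B) 0

lemma re_add_of_commute (h : IsQuasitrace T) {a b : B} (ha : IsSelfAdjoint a)
    (hb : IsSelfAdjoint b) (hab : Commute a b) : (T (a + b)).re = (T a).re + (T b).re := by
  rw [h.add_of_commute ha hb hab, Complex.add_re]

lemma re_smul (h : IsQuasitrace T) {a : B} (ha : IsSelfAdjoint a) (c : ℝ) :
    (T (c • a)).re = c * (T a).re := by
  rw [h.smul_of_isSelfAdjoint ha, Complex.re_ofReal_mul]

lemma norm_one_le : ‖(1 : B)‖ ≤ 1 := by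
  rcases subsingleton_or_nontrivial B with h | h
  · simp [Subsingleton.elim (1:B) 0]
  · simp

lemma re_sum_cfc (h : IsQuasitrace T) {ι : Type*} (s : Finset ι) (f : ι → ℝ → ℝ)
    (hf : ∀ i, Continuous (f i)) (a : B) :
    (T (cfc (fun x => ∑ i ∈ s, f i x) a)).re = ∑ i ∈ s, (T (cfc (f i) a)).re := by
  classical
  by_cases ha : IsSelfAdjoint a
  · induction s using Finset.induction_on with
    | empty => simp [cfc_const_zero, h.zero]
    | insert i s his ih =>
      simp only [Finset.sum_insert his]
      rw [cfc_add (hf := (hf i).continuousOn)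
        (hg := (continuous_finsetSum s fun i _ => hf i).continuousOn),
        h.re_add_of_commute (cfc_predicate _ _) (cfc_predicate _ _) (cfc_commute_cfc _ _ _), ih]
  · simp [cfc_apply_of_not_predicate a ha, h.zero]

lemma re_add_smul_one (h : IsQuasitrace T) {a : B} (ha : IsSelfAdjoint a) (c : ℝ) :
    (T (a + c • (1 : B))).re = (T a).re + c * (T 1).re := by
  rw [h.re_add_of_commute ha (.smul (.all _) (.one B)) ((Commute.one_right _).smul_right _),
    h.re_smul (.one B)]

variable [PartialOrder B] [StarOrderedRing B]

lemma nonneg_of_nonneg (h : IsQuasitrace T) {a : B} (ha : 0 ≤ a) : 0 ≤ T a := by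
  have := h.nonneg (CFC.sqrt a)
  rwa [(CFC.sqrt_nonneg a).isSelfAdjoint.star_eq, CFC.sqrt_mul_sqrt_self a ha] at this

lemma re_nonneg (h : IsQuasitrace T) {a : B} (ha : 0 ≤ a) : 0 ≤ (T a).re :=
  (Complex.nonneg_iff.1 (h.nonneg_of_nonneg ha)).1

lemma im_eq_zero (h : IsQuasitrace T) {a : B} (ha : IsSelfAdjoint a) : (T a).im = 0 := by
  have h1 := h.add_of_commute (a := a + algebraMap ℝ B ‖a‖) (b := (-‖a‖) • (1 : B))
    (ha.add (IsSelfAdjoint.algebraMap B (.all _)))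
    (.smul (.all _) (.one B)) ((Commute.one_right _).smul_right _)
  have hpos : 0 ≤ a + algebraMap ℝ B ‖a‖ := by
    have := ha.neg_algebraMap_norm_le_self
    rwa [neg_le_iff_add_nonneg] at this
  rw [Algebra.algebraMap_eq_smul_one, add_assoc, ← add_smul, add_neg_cancel, zero_smul,
    add_zero, ← Algebra.algebraMap_eq_smul_one, h.smul_of_isSelfAdjoint (.one B)] at h1
  have h2 := (Complex.nonneg_iff.1 (h.nonneg_of_nonneg hpos)).2
  have h3 := (Complex.nonneg_iff.1 (h.nonneg_of_nonneg (zero_le_one (α := B)))).2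
  rw [h1, Complex.add_im, ← h2, Complex.mul_im, ← h3]
  simp

lemma re_mono_of_commute (h : IsQuasitrace T) {a b : B} (ha : IsSelfAdjoint a)
    (hb : IsSelfAdjoint b) (hab : Commute a b) (hle : a ≤ b) : (T a).re ≤ (T b).re := by
  have h1 := h.re_add_of_commute ha (hb.sub ha) (hab.sub_right (Commute.refl a))
  rw [add_sub_cancel] at h1
  linarith [h.re_nonneg (sub_nonneg.2 hle)]

/-- If `f` is a unit for `ww⋆`, then `f` and `ww⋆` commute and `ww⋆ ≤ f`. -/
lemma re_star_mul_self_le (h : IsQuasitrace T) {f w : B} (hf : 0 ≤ f) (hf1 : f ≤ 1)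
    (hfw : f * (w * star w) = w * star w) (hw : star w * w ≤ 1) :
    (T (star w * w)).re ≤ (T f).re := by
  rw [h.tracial]
  have hw0 : 0 ≤ w * star w := mul_star_self_nonneg w
  have hws : IsSelfAdjoint (w * star w) := hw0.isSelfAdjoint
  have hwf : (w * star w) * f = w * star w := by
    have := congrArg star hfw
    rwa [star_mul, hws.star_eq, hf.isSelfAdjoint.star_eq] at this
  refine h.re_mono_of_commute hws hf.isSelfAdjoint (by rw [commute_iff_eq, hfw, hwf]) ?_
  have hw1 : w * star w ≤ 1 := by
    rw [← CStarAlgebra.norm_le_one_iff_of_nonneg _ hw0, CStarRing.norm_self_mul_star]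
    rw [← CStarAlgebra.norm_le_one_iff_of_nonneg _ (star_mul_self_nonneg w),
      CStarRing.norm_star_mul_self] at hw
    exact hw
  have h1 := conj_le_conj_of_isSelfAdjoint hf.isSelfAdjoint hw1
  rw [hfw, hwf, mul_one] at h1
  refine h1.trans ?_
  have h2 := conj_le_conj_of_isSelfAdjoint (CFC.sqrt_nonneg f).isSelfAdjoint hf1
  have hs := CFC.sqrt_mul_sqrt_self f hf
  calc f * f = CFC.sqrt f * (CFC.sqrt f * CFC.sqrt f) * CFC.sqrt f := by
        rw [← mul_assoc, hs, mul_assoc, hs]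
    _ ≤ CFC.sqrt f * 1 * CFC.sqrt f := by rw [hs]; exact h2
    _ = f := by rw [mul_one, hs]

lemma re_ramp_le (h : IsQuasitrace T) {a b : B} (ha : 0 ≤ a) (hab : a ≤ b) {k : ℝ} (hk : 0 ≤ k) :
    (T (cfc (fun x => ramp (x - (k + 4))) a)).re ≤ (T (cfc (fun x => ramp (x - k)) b)).re := by
  obtain ⟨w, hw, hfw⟩ := exists_factorization_ramp ha hab hk
  rw [← hw]
  refine h.re_star_mul_self_le (cfc_nonneg fun x _ => ramp_nonneg _)
    (cfc_le_one _ _ fun x _ => ramp_le_one _) hfw ?_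
  rw [hw]
  exact cfc_le_one _ _ fun x _ => ramp_le_one _

lemma mem_Icc_of_mem_spectrum {a : B} (ha : 0 ≤ a) {x : ℝ} (hx : x ∈ spectrum ℝ a) :
    0 ≤ x ∧ x ≤ ‖a‖ := by
  refine ⟨spectrum_nonneg_of_nonneg ha hx, ?_⟩
  have := spectrum.norm_le_norm_mul_of_mem hx
  exact (le_abs_self x).trans (this.trans (by
    nlinarith [norm_nonneg a, norm_one_le (B := B)]))

/-- The layer cake formula. -/
lemma re_eq_sum_ramp (h : IsQuasitrace T) {a : B} (ha : 0 ≤ a) {K : ℕ} (hK : ‖a‖ ≤ K) :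
    (T a).re = ∑ k ∈ Finset.range K, (T (cfc (fun x => ramp (x - k)) a)).re := by
  rw [← h.re_sum_cfc _ _ (fun i => by fun_prop)]
  congr 2
  conv_lhs => rw [← cfc_id' ℝ a ha.isSelfAdjoint]
  refine cfc_congr fun x hx => ?_
  obtain ⟨h0, h1⟩ := mem_Icc_of_mem_spectrum ha hx
  exact (sum_ramp K h0 (h1.trans hK)).symm

lemma re_le_add (h : IsQuasitrace T) {a b : B} (ha : 0 ≤ a) (hab : a ≤ b) :
    (T a).re ≤ (T b).re + 4 * (T 1).re := by
  obtain ⟨K, hK⟩ := exists_nat_ge (max ‖a‖ ‖b‖)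
  have hKa : ‖a‖ ≤ (K + 4 : ℕ) := by push_cast; linarith [le_max_left ‖a‖ ‖b‖]
  rw [h.re_eq_sum_ramp ha hKa, h.re_eq_sum_ramp (ha.trans hab) ((le_max_right _ _).trans hK),
    add_comm K 4, Finset.sum_range_add, add_comm]
  refine add_le_add ?_ ?_
  · refine Finset.sum_le_sum fun k _ => ?_
    have := h.re_ramp_le ha hab (Nat.cast_nonneg k)
    push_cast
    rwa [add_comm (k : ℝ)] at this
  · refine (Finset.sum_le_card_nsmul _ _ (T 1).re fun k _ => ?_).trans (by simp)
    exact h.re_mono_of_commute (cfc_predicate _ _) (.one B) (Commute.one_right _)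
      (cfc_le_one _ _ fun x _ => ramp_le_one _)

lemma re_mono_of_nonneg (h : IsQuasitrace T) {a b : B} (ha : 0 ≤ a) (hab : a ≤ b) :
    (T a).re ≤ (T b).re := by
  have key : ∀ n : ℕ, n * ((T a).re - (T b).re) ≤ 4 * (T 1).re := by
    intro n
    have h1 := h.re_le_add (smul_nonneg (Nat.cast_nonneg (α := ℝ) n) ha)
      (smul_le_smul_of_nonneg_left hab (Nat.cast_nonneg (α := ℝ) n))
    rw [h.re_smul ha.isSelfAdjoint, h.re_smul (ha.trans hab).isSelfAdjoint] at h1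
    linarith
  by_contra hcon
  push Not at hcon
  obtain ⟨n, hn⟩ := Archimedean.arch (4 * (T 1).re + 1) (sub_pos.2 hcon)
  have := key n
  rw [nsmul_eq_mul] at hn
  linarith

lemma re_mono (h : IsQuasitrace T) {a b : B} (ha : IsSelfAdjoint a) (hb : IsSelfAdjoint b)
    (hab : a ≤ b) : (T a).re ≤ (T b).re := by
  have h0 : 0 ≤ a + ‖a‖ • (1 : B) := by
    have := ha.neg_algebraMap_norm_le_self
    rwa [neg_le_iff_add_nonneg, Algebra.algebraMap_eq_smul_one] at this
  have h1 := h.re_mono_of_nonneg h0 (by gcongr : a + ‖a‖ • (1 : B) ≤ b + ‖a‖ • (1 : B))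
  rw [h.re_add_smul_one ha, h.re_add_smul_one hb] at h1
  linarith

end IsQuasitrace

/-! ### The properties of quasitraces that survive limits -/

/-- The order-theoretic properties of the real part of a 2-quasitrace that survive under limits. Only
the values on self-adjoint elements are constrained. Existence of an extension to two by two matrices
is reflected in `add_le`, a weak form of subadditivity. -/
structure OrderedQuasitrace {B : Type*} [CStarAlgebra B] [PartialOrder B] [StarOrderedRing B]
    (t : B → ℝ) : Prop where
  mono : ∀ a b : B, IsSelfAdjoint a → IsSelfAdjoint b → a ≤ b → t a ≤ t b
  tracial : ∀ x : B, t (star x * x) = t (x * star x)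
  smul : ∀ (c : ℝ) (a : B), IsSelfAdjoint a → t (c • a) = c * t a
  add_smul_one : ∀ (a : B) (c : ℝ), IsSelfAdjoint a → t (a + c • (1 : B)) = t a + c * t 1
  map_cfc_add : ∀ (h : B) (f g : ℝ → ℝ), IsSelfAdjoint h → Continuous f → Continuous g →
    t (cfc f h + cfc g h) = t (cfc f h) + t (cfc g h)
  add_le : ∀ (a b : B) (s : ℝ), 0 ≤ a → 0 ≤ b → 0 < s →
    t (a + b) ≤ (1 + s) * t a + (1 + s⁻¹) * t b

namespace OrderedQuasitrace

variable {B : Type*} [CStarAlgebra B] [PartialOrder B] [StarOrderedRing B] {t : B → ℝ}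

lemma zero (ht : OrderedQuasitrace t) : t 0 = 0 := by
  simpa using ht.smul 0 0 (.zero B)

lemma nonneg (ht : OrderedQuasitrace t) {a : B} (ha : 0 ≤ a) : 0 ≤ t a := by
  rw [← ht.zero]
  exact ht.mono _ _ (.zero B) ha.isSelfAdjoint ha

lemma one_nonneg (ht : OrderedQuasitrace t) : 0 ≤ t 1 := ht.nonneg zero_le_one

lemma le_add_of_le (ht : OrderedQuasitrace t) {a b : B} {c : ℝ} (ha : IsSelfAdjoint a)
    (hb : IsSelfAdjoint b) (h : a ≤ b + c • (1 : B)) : t a ≤ t b + c * t 1 := by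
  rw [← ht.add_smul_one b c hb]
  exact ht.mono _ _ ha (hb.add (.smul (.all _) (.one B))) h

lemma abs_sub_le (ht : OrderedQuasitrace t) {a b : B} (ha : IsSelfAdjoint a)
    (hb : IsSelfAdjoint b) : |t a - t b| ≤ ‖a - b‖ * t 1 := by
  have h : ∀ x y : B, IsSelfAdjoint x → IsSelfAdjoint y → t x ≤ t y + ‖x - y‖ * t 1 := by
    intro x y hx hy
    refine ht.le_add_of_le hx hy ?_
    have := (hx.sub hy).le_algebraMap_norm_self
    rwa [Algebra.algebraMap_eq_smul_one, sub_le_iff_le_add'] at this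
  rw [abs_sub_le_iff]
  refine ⟨by linarith [h a b ha hb], ?_⟩
  have := h b a hb ha
  rw [norm_sub_rev] at this
  linarith

lemma sum_cfc (ht : OrderedQuasitrace t) {ι : Type*} (s : Finset ι) (f : ι → ℝ → ℝ)
    (hf : ∀ i, Continuous (f i)) {a : B} (ha : IsSelfAdjoint a) :
    t (cfc (fun x => ∑ i ∈ s, f i x) a) = ∑ i ∈ s, t (cfc (f i) a) := by
  classical
  induction s using Finset.induction_on with
  | empty => simp [cfc_const_zero, ht.zero]
  | insert i s his ih =>
    have hs : Continuous fun x => ∑ i ∈ s, f i x := continuous_finsetSum s fun i _ => hf i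
    simp only [Finset.sum_insert his]
    rw [cfc_add (hf := (hf i).continuousOn) (hg := hs.continuousOn),
      ht.map_cfc_add a _ _ ha (hf i) hs, ih]

/-- Orthogonal positive elements are the positive and negative part of their difference. -/
lemma add_of_mul_eq_zero (ht : OrderedQuasitrace t) {a b : B} (ha : 0 ≤ a) (hb : 0 ≤ b)
    (hab : a * b = 0) : t (a + b) = t a + t b := by
  have hs : IsSelfAdjoint (a - b) := ha.isSelfAdjoint.sub hb.isSelfAdjoint
  obtain ⟨h1, h2⟩ := CFC.posPart_negPart_unique (a := a - b) rfl hab ha hb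
  have e1 : cfc (fun x : ℝ => x⁺) (a - b) = a := by
    rw [← cfcₙ_eq_cfc, ← CFC.posPart_def, h1]
  have e2 : cfc (fun x : ℝ => x⁻) (a - b) = b := by
    rw [← cfcₙ_eq_cfc, ← CFC.negPart_def, h2]
  have := ht.map_cfc_add (a - b) (fun x => x⁺) (fun x => x⁻) hs (by fun_prop) (by fun_prop)
  rwa [e1, e2] at this

lemma sum_of_pairwise (ht : OrderedQuasitrace t) {ι : Type*} (s : Finset ι) (e : ι → B) (c : ι → ℝ)
    (he : ∀ i, 0 ≤ e i) (hc : ∀ i, 0 ≤ c i) (horth : ∀ i j, i ≠ j → e i * e j = 0) :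
    t (∑ i ∈ s, c i • e i) = ∑ i ∈ s, c i * t (e i) := by
  classical
  induction s using Finset.induction_on with
  | empty => simp [ht.zero]
  | insert i s his ih =>
    rw [Finset.sum_insert his, Finset.sum_insert his, ht.add_of_mul_eq_zero
      (smul_nonneg (hc i) (he i)) (Finset.sum_nonneg fun j _ => smul_nonneg (hc j) (he j)), ih,
      ht.smul _ _ (he i).isSelfAdjoint]
    rw [Finset.mul_sum]
    refine Finset.sum_eq_zero fun j hj => ?_
    rw [smul_mul_smul_comm, horth i j (fun h => his (h ▸ hj)), smul_zero]

/-- For a fixed bound on `t x`, the map `t` is almost unaffected by adding elements on which `t` is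
small. -/
lemma exists_small (ht : OrderedQuasitrace t) (C : ℝ) : ∃ δ > 0, ∀ x y : B, 0 ≤ x → 0 ≤ y →
    t x ≤ C → t y ≤ δ → t (x + y) ≤ t x + 1 := by
  set D := |C| + 1
  have hD : 0 < D := by positivity
  refine ⟨(2 * (1 + 2 * D))⁻¹, by positivity, fun x y hx hy hxC hyδ => ?_⟩
  have h := ht.add_le x y (2 * D)⁻¹ hx hy (by positivity)
  rw [inv_inv] at h
  have h1 : (2 * D)⁻¹ * t x ≤ 1 / 2 := by
    calc (2 * D)⁻¹ * t x ≤ (2 * D)⁻¹ * D := by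
          gcongr
          linarith [le_abs_self C]
      _ = 1 / 2 := by field_simp
  have h2 : (1 + 2 * D) * t y ≤ 1 / 2 := by
    calc (1 + 2 * D) * t y ≤ (1 + 2 * D) * (2 * (1 + 2 * D))⁻¹ := by gcongr
      _ = 1 / 2 := by field_simp
  linarith

end OrderedQuasitrace

/-! ### Partitions of the real line into cells -/

section Cells

/-- Scaled ramps `x ↦ ramp (M x - i)`. -/
noncomputable def stair (M : ℕ) (i : ℕ) (x : ℝ) : ℝ := ramp (M * x - i)

@[fun_prop]
lemma continuous_stair (M i : ℕ) : Continuous (stair M i) := by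
  unfold stair; fun_prop

lemma stair_antitone (M : ℕ) (x : ℝ) : Antitone fun i => stair M i x := fun i j h => by
  have : (i : ℝ) ≤ j := by exact_mod_cast h
  exact ramp_mono (by linarith)

lemma stair_eq_zero {M i : ℕ} {x : ℝ} (h : M * x ≤ i) : stair M i x = 0 :=
  ramp_of_nonpos (by linarith)

lemma stair_eq_one {M i : ℕ} {x : ℝ} (h : i + 1 ≤ M * x) : stair M i x = 1 :=
  ramp_of_one_le (by linarith)

lemma stair_nonneg (M i : ℕ) (x : ℝ) : 0 ≤ stair M i x := ramp_nonneg _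

lemma stair_le_one (M i : ℕ) (x : ℝ) : stair M i x ≤ 1 := ramp_le_one _

/-- The `k`-th trapezoid, supported on an open interval of length `1` around `k + (m + 1) / M + 1 / 2`.
Trapezoids with different `k` have disjoint supports. -/
noncomputable def cell (M m k : ℕ) (x : ℝ) : ℝ :=
  stair M (k * M + m + 1) x - stair M (k * M + M + m) x

/-- What is missing from the sum of the trapezoids: small tents around the points where two
adjacent supports meet. -/
noncomputable def gap (M m K : ℕ) (x : ℝ) : ℝ :=
  ∑ k ∈ Finset.range K, (stair M (k * M + m) x - stair M (k * M + m + 1) x)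

@[fun_prop]
lemma continuous_cell (M m k : ℕ) : Continuous (cell M m k) := by unfold cell; fun_prop

@[fun_prop]
lemma continuous_gap (M m K : ℕ) : Continuous (gap M m K) := by
  unfold gap; fun_prop

lemma cell_nonneg {M : ℕ} (hM : 1 ≤ M) (m k : ℕ) (x : ℝ) : 0 ≤ cell M m k x :=
  sub_nonneg.2 (stair_antitone M x (by lia))

lemma gap_nonneg (M m K : ℕ) (x : ℝ) : 0 ≤ gap M m K x :=
  Finset.sum_nonneg fun _ _ => sub_nonneg.2 (stair_antitone M x (by lia))

lemma lt_of_cell_ne_zero {M m k : ℕ} (hM : 1 ≤ M) {x : ℝ} (h : cell M m k x ≠ 0) :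
    (k * M + m + 1 : ℝ) < M * x ∧ M * x < k * M + M + m + 1 := by
  constructor
  · by_contra hcon
    push Not at hcon
    refine h ?_
    have hM' : (1 : ℝ) ≤ M := by exact_mod_cast hM
    rw [cell, stair_eq_zero (by push_cast; linarith), stair_eq_zero (by push_cast; linarith),
      sub_self]
  · by_contra hcon
    push Not at hcon
    refine h ?_
    have hM' : (1 : ℝ) ≤ M := by exact_mod_cast hM
    rw [cell, stair_eq_one (by push_cast; linarith), stair_eq_one (by push_cast; linarith),
      sub_self]

lemma cell_mul_cell {M m k l : ℕ} (hM : 1 ≤ M) (hkl : k ≠ l) (x : ℝ) :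
    cell M m k x * cell M m l x = 0 := by
  wlog h : k < l generalizing k l
  · rw [mul_comm]; exact this hkl.symm (by lia)
  by_contra hne
  obtain ⟨h1, h2⟩ := mul_ne_zero_iff.1 hne
  have a1 := (lt_of_cell_ne_zero hM h1).2
  have a2 := (lt_of_cell_ne_zero hM h2).1
  have a3 : ((k + 1) * M + m + 1 : ℝ) ≤ l * M + m + 1 := by
    have : (k + 1 : ℝ) ≤ l := by exact_mod_cast h
    gcongr
  linarith

lemma abs_sub_mul_cell_le {M m k : ℕ} (hm : m < M) (x : ℝ) :
    |(x - (k + 1)) * cell M m k x| ≤ cell M m k x := by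
  have hM : 1 ≤ M := by lia
  by_cases h : cell M m k x = 0
  · simp [h]
  obtain ⟨h1, h2⟩ := lt_of_cell_ne_zero hM h
  have hM0 : (0 : ℝ) < M := by exact_mod_cast hM
  have hm' : (m + 1 : ℝ) ≤ M := by exact_mod_cast hm
  rw [abs_mul, abs_of_nonneg (cell_nonneg hM m k x)]
  refine mul_le_of_le_one_left (cell_nonneg hM m k x) ?_
  rw [abs_le]
  have hm0 : (0 : ℝ) ≤ m := Nat.cast_nonneg m
  constructor <;> nlinarith

lemma gap_add_sum_cell {M m K : ℕ} (hm : m < M) {x : ℝ} (h1 : 1 ≤ x) (hK : x ≤ K) :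
    gap M m K x + ∑ k ∈ Finset.range K, cell M m k x = 1 := by
  rw [gap, ← Finset.sum_add_distrib]
  have : ∀ k, (stair M (k * M + m) x - stair M (k * M + m + 1) x) + cell M m k x
      = stair M (k * M + m) x - stair M ((k + 1) * M + m) x := by
    intro k
    rw [cell, show (k + 1) * M + m = k * M + M + m by ring]; ring
  simp only [this]
  rw [Finset.sum_range_sub' (fun k => stair M (k * M + m) x)]
  have hm' : (m + 1 : ℝ) ≤ M := by exact_mod_cast hm
  have hm0 : (0 : ℝ) ≤ m := Nat.cast_nonneg m
  rw [stair_eq_one (by push_cast; nlinarith), stair_eq_zero (by push_cast; nlinarith), sub_zero]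

lemma sum_gap_le_one (M K : ℕ) (x : ℝ) : ∑ m ∈ Finset.range M, gap M m K x ≤ 1 := by
  simp only [gap]
  rw [Finset.sum_comm]
  have : ∀ k, ∑ m ∈ Finset.range M, (stair M (k * M + m) x - stair M (k * M + m + 1) x)
      = stair M (k * M) x - stair M ((k + 1) * M) x := by
    intro k
    rw [show (k + 1) * M = k * M + M by ring]
    exact Finset.sum_range_sub' (fun m => stair M (k * M + m) x) M
  simp only [this]
  rw [Finset.sum_range_sub' (fun k => stair M (k * M) x)]
  linarith [stair_le_one M (0 * M) x, stair_nonneg M (K * M) x]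

end Cells

/-! ### Additivity on commuting elements -/

namespace OrderedQuasitrace

variable {B : Type*} [CStarAlgebra B] [PartialOrder B] [StarOrderedRing B] {t : B → ℝ}

/-- Up to an element on which `t` is small, the unit splits into orthogonal functions of `a` on each
of which `a` is within distance `1` of a scalar. The position of the cuts between them is chosen among
`M` disjoint ones, so that one of them has measure at most `t 1 / M`. -/
lemma exists_cells (ht : OrderedQuasitrace t) {a : B} (ha : 1 ≤ a) {δ : ℝ} (hδ : 0 < δ) :
    ∃ (K : ℕ) (f : ℕ → B) (g : B),
      (∀ y, Commute a y → (∀ k, Commute (f k) y) ∧ Commute g y) ∧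
      (∀ k, 0 ≤ f k) ∧ (∀ k l, k ≠ l → f k * f l = 0) ∧
      (∀ k : ℕ, -f k ≤ (a - ((k : ℝ) + 1) • (1 : B)) * f k ∧
        (a - ((k : ℝ) + 1) • (1 : B)) * f k ≤ f k) ∧
      ∑ k ∈ Finset.range K, f k = 1 - g ∧ 0 ≤ g ∧ g ≤ 1 ∧ t g ≤ δ := by
  have ha0 : 0 ≤ a := zero_le_one.trans ha
  have hsa : IsSelfAdjoint a := ha0.isSelfAdjoint
  obtain ⟨K, hK⟩ := exists_nat_ge ‖a‖
  obtain ⟨M, hM⟩ := exists_nat_gt (t 1 / δ)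
  have hM0 : 0 < (M : ℝ) := (div_nonneg ht.one_nonneg hδ.le).trans_lt hM
  have hM1 : 1 ≤ M := by exact_mod_cast hM0
  have hspec : ∀ x ∈ spectrum ℝ a, 1 ≤ x ∧ x ≤ K := fun x hx =>
    ⟨(CFC.one_le_iff a).1 ha x hx, (IsQuasitrace.mem_Icc_of_mem_spectrum ha0 hx).2.trans hK⟩
  obtain ⟨m, hmM, hm⟩ : ∃ m < M, t (cfc (gap M m K) a) ≤ δ := by
    by_contra hcon
    push Not at hcon
    have h1 : ∑ m ∈ Finset.range M, δ ≤ ∑ m ∈ Finset.range M, t (cfc (gap M m K) a) :=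
      Finset.sum_le_sum fun m hm => (hcon m (Finset.mem_range.1 hm)).le
    rw [← ht.sum_cfc _ _ (fun m => by fun_prop) hsa] at h1
    have h2 := ht.mono (cfc (fun x => ∑ m ∈ Finset.range M, gap M m K x) a) 1 (cfc_predicate _ _)
      (.one B) (cfc_le_one _ _ fun x _ => sum_gap_le_one M K x)
    rw [Finset.sum_const, Finset.card_range, nsmul_eq_mul] at h1
    rw [div_lt_iff₀ hδ] at hM
    linarith
  have hgle : ∀ x ∈ spectrum ℝ a, gap M m K x ≤ 1 := fun x hx => by
    have h1 := gap_add_sum_cell hmM (hspec x hx).1 (hspec x hx).2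
    have h2 : 0 ≤ ∑ k ∈ Finset.range K, cell M m k x :=
      Finset.sum_nonneg fun k _ => cell_nonneg hM1 m k x
    linarith
  have hmul : ∀ k : ℕ, (a - ((k : ℝ) + 1) • (1 : B)) * cfc (cell M m k) a
      = cfc (fun x => (x - (k + 1)) * cell M m k x) a := by
    intro k
    rw [cfc_mul _ _ a, cfc_sub _ _ a, cfc_id' ℝ a, cfc_const _ a,
      Algebra.algebraMap_eq_smul_one]
  refine ⟨K, fun k => cfc (cell M m k) a, cfc (gap M m K) a, fun y hy => ⟨fun k => ?_, ?_⟩,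
    fun k => cfc_nonneg fun x _ => cell_nonneg hM1 m k x, fun k l hkl => ?_, fun k => ⟨?_, ?_⟩,
    ?_, cfc_nonneg fun x _ => gap_nonneg M m K x, cfc_le_one _ _ hgle, hm⟩
  · exact hy.cfc_real _
  · exact hy.cfc_real _
  · rw [← cfc_mul _ _ a]
    simp only [cell_mul_cell hM1 hkl]
    exact cfc_const_zero ℝ a
  · rw [hmul, ← cfc_neg]
    exact cfc_mono fun x _ => (abs_le.1 (abs_sub_mul_cell_le hmM x)).1
  · rw [hmul]
    exact cfc_mono fun x _ => (abs_le.1 (abs_sub_mul_cell_le hmM x)).2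
  · rw [← cfc_sum _ _ _ (fun i _ => by fun_prop), eq_sub_iff_add_eq,
      ← cfc_add (hf := by
        rw [Finset.sum_fn]
        exact (continuous_finsetSum _ fun i _ => continuous_cell M m i).continuousOn)
        (hg := (continuous_gap M m K).continuousOn)]
    conv_rhs => rw [← cfc_const_one ℝ a]
    refine cfc_congr fun x hx => ?_
    have := gap_add_sum_cell hmM (hspec x hx).1 (hspec x hx).2
    simp only [Finset.sum_apply]
    linarith

/-- Additivity up to an error that does not depend on the size of `a` and `b`: the products of the
cells of `a` and of `b` form a grid of orthogonal positive elements, on whose linear combinations `t`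
is additive, and after cutting down by their sum `a` and `b` are within distance `1` of such linear
combinations. -/
lemma abs_add_sub_le_of_one_le (ht : OrderedQuasitrace t) {a b : B} (ha : 1 ≤ a) (hb : 1 ≤ b)
    (hab : Commute a b) : |t (a + b) - t a - t b| ≤ 4 * t 1 + 3 := by
  have ha0 : 0 ≤ a := zero_le_one.trans ha
  have hb0 : 0 ≤ b := zero_le_one.trans hb
  obtain ⟨δ, hδ, hsmall⟩ := ht.exists_small (t (a + b))
  set C : ℝ := ‖a + b‖ + 1
  have hC : 0 < C := by positivity
  obtain ⟨K, f, g, hf, hf0, hff, hfa, hfs, hg0, hg1, hgt⟩ :=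
    ht.exists_cells ha (δ := δ / (4 * C)) (by positivity)
  obtain ⟨K', f', g', hf', hf0', hff', hfb, hfs', hg0', hg1', hgt'⟩ :=
    ht.exists_cells hb (δ := δ / (4 * C)) (by positivity)
  -- every element in sight commutes with every other one
  have cab : Commute b a := hab.symm
  have caf : ∀ k, Commute (f k) a := (hf a (Commute.refl a)).1
  have cbf : ∀ k, Commute (f k) b := (hf b hab).1
  have cag : Commute g a := (hf a (Commute.refl a)).2
  have cbg : Commute g b := (hf b hab).2
  have caf' : ∀ k, Commute (f' k) a := (hf' a cab).1
  have cbf' : ∀ k, Commute (f' k) b := (hf' b (Commute.refl b)).1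
  have cag' : Commute g' a := (hf' a cab).2
  have cbg' : Commute g' b := (hf' b (Commute.refl b)).2
  have cff' : ∀ k l, Commute (f k) (f' l) := fun k l => (hf (f' l) (caf' l).symm).1 k
  have cgg' : Commute g g' := (hf g' cag'.symm).2
  set e : ℕ × ℕ → B := fun i => f i.1 * f' i.2
  set s := Finset.range K ×ˢ Finset.range K'
  set p := (1 - g) * (1 - g')
  have he0 : ∀ i, 0 ≤ e i := fun i => (cff' i.1 i.2).mul_nonneg (hf0 _) (hf0' _)
  have hee : ∀ i j, i ≠ j → e i * e j = 0 := by
    rintro ⟨k, l⟩ ⟨k', l'⟩ hne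
    have h1 : e (k, l) * e (k', l') = (f k * f k') * (f' l * f' l') :=
      (cff' k' l).symm.mul_mul_mul_comm _ _
    rw [h1]
    by_cases hk : k = k'
    · rw [hff' l l' (fun h => hne (by rw [hk, h])), mul_zero]
    · rw [hff k k' hk, zero_mul]
  have hes : ∑ i ∈ s, e i = p := by
    simp only [p, e, s]
    rw [← hfs, ← hfs', Finset.sum_mul_sum, Finset.sum_product]
  have hp0 : 0 ≤ p := by rw [← hes]; exact Finset.sum_nonneg fun i _ => he0 i
  have hpc : ∀ y, Commute g y → Commute g' y → Commute p y := fun y h1 h2 =>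
    ((Commute.one_left y).sub_left h1).mul_left ((Commute.one_left y).sub_left h2)
  have hp1 : p ≤ 1 := by
    have h1 : 0 ≤ g + (1 - g) * g' := add_nonneg hg0
      (((Commute.one_left _).sub_left cgg').mul_nonneg (sub_nonneg.2 hg1) hg0')
    have h2 : 1 - p = g + (1 - g) * g' := by simp only [p]; noncomm_ring
    rw [← sub_nonneg, h2]; exact h1
  have hps : t (1 - p) ≤ δ / C := by
    have h1 : 1 - p ≤ g + g' := by
      have h2 : g + g' - (1 - p) = g * g' := by simp only [p]; noncomm_ring
      rw [← sub_nonneg, h2]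
      exact cgg'.mul_nonneg hg0 hg0'
    have h2 := ht.mono _ _ (sub_nonneg.2 hp1).isSelfAdjoint (add_nonneg hg0 hg0').isSelfAdjoint h1
    have h3 := ht.add_le g g' 1 hg0 hg0' one_pos
    have h4 : δ / C = 4 * (δ / (4 * C)) := by field_simp
    rw [h4]
    norm_num at h3
    linarith
  -- cutting down by `p` changes the value of `t` by at most `1`
  have hcut : ∀ x : B, 0 ≤ x → Commute p x → x ≤ a + b →
      t (x * p) ≤ t x ∧ t x ≤ t (x * p) + 1 := by
    intro x hx hpx hxab
    have c1 : Commute x (1 - p) := (Commute.one_right x).sub_right hpx.symm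
    have n1 : 0 ≤ x * p := hpx.symm.mul_nonneg hx hp0
    have n2 : 0 ≤ x * (1 - p) := c1.mul_nonneg hx (sub_nonneg.2 hp1)
    have h0 : x * p + x * (1 - p) = x := by noncomm_ring
    have h1 : t (x * p) ≤ t x := by
      refine ht.mono _ _ n1.isSelfAdjoint hx.isSelfAdjoint ?_
      conv_rhs => rw [← h0]
      exact le_add_of_nonneg_right n2
    refine ⟨h1, ?_⟩
    have h2 := hsmall _ _ n1 n2 (h1.trans (ht.mono _ _ hx.isSelfAdjoint
      (add_nonneg ha0 hb0).isSelfAdjoint hxab)) ?_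
    · rwa [h0] at h2
    have h3 : x ≤ C • (1 : B) := by
      have h4 := (hx.trans hxab).isSelfAdjoint.le_algebraMap_norm_self
      rw [Algebra.algebraMap_eq_smul_one] at h4
      refine (hxab.trans h4).trans ?_
      exact smul_le_smul_of_nonneg_right (by simp [C]) zero_le_one
    have h5 : x * (1 - p) ≤ C • (1 - p) := by
      have h6 : C • (1 - p) - x * (1 - p) = (C • (1 : B) - x) * (1 - p) := by
        rw [sub_mul, smul_mul_assoc, one_mul]
      rw [← sub_nonneg, h6]
      exact (((Commute.one_left _).smul_left C).sub_left c1).mul_nonneg (sub_nonneg.2 h3)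
        (sub_nonneg.2 hp1)
    refine (ht.mono _ _ n2.isSelfAdjoint (.smul (.all _) (sub_nonneg.2 hp1).isSelfAdjoint)
      h5).trans ?_
    rw [ht.smul _ _ (sub_nonneg.2 hp1).isSelfAdjoint]
    calc C * t (1 - p) ≤ C * (δ / C) := by gcongr
      _ = δ := by field_simp
  -- on each cell, `a` and `b` are within distance `1` of a scalar
  set D : B := ∑ i ∈ s, ((i.1 : ℝ) + 1) • e i
  set D' : B := ∑ i ∈ s, ((i.2 : ℝ) + 1) • e i
  have hD0 : 0 ≤ D := Finset.sum_nonneg fun i _ => smul_nonneg (by positivity) (he0 i)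
  have hD0' : 0 ≤ D' := Finset.sum_nonneg fun i _ => smul_nonneg (by positivity) (he0 i)
  have htD : t (D + D') = t D + t D' := by
    have h1 : D + D' = ∑ i ∈ s, (((i.1 : ℝ) + 1) + ((i.2 : ℝ) + 1)) • e i := by
      simp only [D, D', ← Finset.sum_add_distrib, ← add_smul]
    rw [h1, ht.sum_of_pairwise s e _ he0 (fun i => by positivity) hee,
      ht.sum_of_pairwise s e _ he0 (fun i => by positivity) hee,
      ht.sum_of_pairwise s e _ he0 (fun i => by positivity) hee, ← Finset.sum_add_distrib]
    exact Finset.sum_congr rfl fun i _ => add_mul _ _ _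
  have haD : -1 ≤ a * p - D ∧ a * p - D ≤ 1 := by
    have h1 : a * p - D = ∑ i ∈ s, ((a - ((i.1 : ℝ) + 1) • (1 : B)) * f i.1) * f' i.2 := by
      simp only [D, ← hes, Finset.mul_sum, ← Finset.sum_sub_distrib]
      refine Finset.sum_congr rfl fun i _ => ?_
      simp only [e, sub_mul, smul_mul_assoc, one_mul, mul_assoc]
    have c : ∀ i : ℕ × ℕ, Commute ((a - ((i.1 : ℝ) + 1) • (1 : B)) * f i.1) (f' i.2) := fun i =>
      (((caf' i.2).symm.sub_left ((Commute.one_left _).smul_left _))).mul_left (cff' _ _)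
    rw [h1]
    constructor
    · refine (neg_le_neg hp1).trans ?_
      rw [← hes, ← Finset.sum_neg_distrib]
      refine Finset.sum_le_sum fun i _ => ?_
      rw [← sub_nonneg]
      have := ((c i).sub_left (cff' i.1 i.2).neg_left).mul_nonneg
        (sub_nonneg.2 (hfa i.1).1) (hf0' i.2)
      rwa [sub_mul, neg_mul] at this
    · refine le_trans ?_ hp1
      rw [← hes]
      refine Finset.sum_le_sum fun i _ => ?_
      rw [← sub_nonneg]
      have := ((cff' i.1 i.2).sub_left (c i)).mul_nonneg
        (sub_nonneg.2 (hfa i.1).2) (hf0' i.2)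
      rwa [sub_mul] at this
  have hbD : -1 ≤ b * p - D' ∧ b * p - D' ≤ 1 := by
    have h1 : b * p - D' = ∑ i ∈ s, f i.1 * ((b - ((i.2 : ℝ) + 1) • (1 : B)) * f' i.2) := by
      simp only [D', ← hes, Finset.mul_sum, ← Finset.sum_sub_distrib]
      refine Finset.sum_congr rfl fun i _ => ?_
      simp only [e, sub_mul, smul_mul_assoc, one_mul, mul_sub, mul_smul_comm]
      rw [← mul_assoc, ← (cbf i.1).eq, mul_assoc]
    have c : ∀ i : ℕ × ℕ, Commute (f i.1) ((b - ((i.2 : ℝ) + 1) • (1 : B)) * f' i.2) := fun i =>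
      (((cbf i.1).sub_right ((Commute.one_right _).smul_right _))).mul_right (cff' _ _)
    rw [h1]
    constructor
    · refine (neg_le_neg hp1).trans ?_
      rw [← hes, ← Finset.sum_neg_distrib]
      refine Finset.sum_le_sum fun i _ => ?_
      rw [← sub_nonneg]
      have := ((c i).sub_right (cff' i.1 i.2).neg_right).mul_nonneg (hf0 i.1)
        (sub_nonneg.2 (hfb i.2).1)
      rwa [mul_sub, mul_neg] at this
    · refine le_trans ?_ hp1
      rw [← hes]
      refine Finset.sum_le_sum fun i _ => ?_
      rw [← sub_nonneg]
      have := ((cff' i.1 i.2).sub_right (c i)).mul_nonneg (hf0 i.1)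
        (sub_nonneg.2 (hfb i.2).2)
      rwa [mul_sub] at this
  have hclose : ∀ (x y : B) (c : ℝ), IsSelfAdjoint x → IsSelfAdjoint y → -(c • (1 : B)) ≤ x - y →
      x - y ≤ c • (1 : B) → |t x - t y| ≤ c * t 1 := by
    intro x y c hx hy h1 h2
    rw [abs_sub_le_iff]
    constructor
    · have := ht.le_add_of_le hx hy (sub_le_iff_le_add'.1 h2)
      linarith
    · have h3 : y ≤ x + c • (1 : B) := by
        rw [neg_le, neg_sub, sub_le_iff_le_add'] at h1
        exact h1
      have := ht.le_add_of_le hy hx h3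
      linarith
  have cpa : Commute p a := hpc a cag cag'
  have cpb : Commute p b := hpc b cbg cbg'
  have npa : 0 ≤ a * p := cpa.symm.mul_nonneg ha0 hp0
  have npb : 0 ≤ b * p := cpb.symm.mul_nonneg hb0 hp0
  have k1 := hclose (a * p) D 1 npa.isSelfAdjoint hD0.isSelfAdjoint (by simpa using haD.1)
    (by simpa using haD.2)
  have k2 := hclose (b * p) D' 1 npb.isSelfAdjoint hD0'.isSelfAdjoint (by simpa using hbD.1)
    (by simpa using hbD.2)
  have h3 : (a + b) * p - (D + D') = (a * p - D) + (b * p - D') := by rw [add_mul]; abel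
  have k3 := hclose ((a + b) * p) (D + D') 2 (by rw [add_mul]; exact (add_nonneg npa npb).isSelfAdjoint)
    (add_nonneg hD0 hD0').isSelfAdjoint
    (by rw [h3, two_smul, neg_add]; exact add_le_add haD.1 hbD.1)
    (by rw [h3, two_smul]; exact add_le_add haD.2 hbD.2)
  have m1 := hcut a ha0 cpa (le_add_of_nonneg_right hb0)
  have m2 := hcut b hb0 cpb (le_add_of_nonneg_left ha0)
  have m3 := hcut (a + b) (add_nonneg ha0 hb0) (cpa.add_right cpb) le_rfl
  rw [abs_le] at k1 k2 k3 ⊢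
  constructor <;> linarith [m1.1, m1.2, m2.1, m2.2, m3.1, m3.2, k1.1, k1.2, k2.1, k2.2, k3.1, k3.2]

/-- The error term in `abs_add_sub_le_of_one_le` does not depend on the size of `a` and `b`, so it
disappears on rescaling. -/
lemma add_of_commute (ht : OrderedQuasitrace t) {a b : B} (ha : IsSelfAdjoint a)
    (hb : IsSelfAdjoint b) (hab : Commute a b) : t (a + b) = t a + t b := by
  have key : ∀ x : B, IsSelfAdjoint x → 1 ≤ x + (‖x‖ + 1) • (1 : B) := by
    intro x hx
    have := hx.neg_algebraMap_norm_le_self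
    rw [neg_le_iff_add_nonneg, Algebra.algebraMap_eq_smul_one] at this
    rw [add_smul, one_smul, ← add_assoc]
    exact le_add_of_nonneg_left this
  set x := a + (‖a‖ + 1) • (1 : B)
  set y := b + (‖b‖ + 1) • (1 : B)
  have hx : 1 ≤ x := key a ha
  have hy : 1 ≤ y := key b hb
  have hxs : IsSelfAdjoint x := (zero_le_one.trans hx).isSelfAdjoint
  have hys : IsSelfAdjoint y := (zero_le_one.trans hy).isSelfAdjoint
  have hxy : Commute x y := by
    refine Commute.add_left ?_ ((Commute.one_left _).smul_left _)
    exact hab.add_right ((Commute.one_right _).smul_right _)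
  have hbound : ∀ n : ℕ, n * |t (x + y) - t x - t y| ≤ 4 * t 1 + 3 + |t (x + y) - t x - t y| := by
    intro n
    rcases Nat.eq_zero_or_pos n with rfl | hn
    · have := ht.one_nonneg; simp; positivity
    have hn1 : (1 : ℝ) ≤ n := by exact_mod_cast hn
    have hone : ∀ z : B, 1 ≤ z → 1 ≤ (n : ℝ) • z := fun z hz => by
      refine hz.trans ?_
      conv_lhs => rw [← one_smul ℝ z]
      exact smul_le_smul_of_nonneg_right hn1 (zero_le_one.trans hz)
    have := ht.abs_add_sub_le_of_one_le (hone x hx) (hone y hy)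
      ((hxy.smul_left (n : ℝ)).smul_right (n : ℝ))
    rw [← smul_add, ht.smul _ _ (hxs.add hys), ht.smul _ _ hxs, ht.smul _ _ hys, ← mul_sub,
      ← mul_sub, abs_mul, abs_of_nonneg (Nat.cast_nonneg n)] at this
    linarith [abs_nonneg (t (x + y) - t x - t y)]
  have hzero : t (x + y) - t x - t y = 0 := by
    by_contra hne
    have hpos := abs_pos.2 hne
    obtain ⟨n, hn⟩ := Archimedean.arch (4 * t 1 + 3 + |t (x + y) - t x - t y| + 1) hpos
    rw [nsmul_eq_mul] at hn
    linarith [hbound n]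
  have hsum : x + y = (a + b) + (‖a‖ + 1 + (‖b‖ + 1)) • (1 : B) := by
    rw [add_smul]; simp only [x, y]; abel
  rw [hsum, ht.add_smul_one _ _ (ha.add hb), ht.add_smul_one _ _ ha, ht.add_smul_one _ _ hb] at hzero
  linarith

end OrderedQuasitrace

/-! ### Matrix algebras -/

section MatrixMaps

variable {A : Type*} [CStarAlgebra A]

lemma pad_apply {n : ℕ} (m : ℕ) (a : Mat n A) (i j : Fin m) :
    pad m a i j = if h : (i : ℕ) < n ∧ (j : ℕ) < n then a ⟨i, h.1⟩ ⟨j, h.2⟩ else 0 := rfl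

lemma pad_mul {n m : ℕ} (h : n ≤ m) (a b : Mat n A) : pad m (a * b) = pad m a * pad m b := by
  ext i j
  rw [CStarMatrix.mul_apply]
  simp only [pad_apply]
  by_cases hij : (i : ℕ) < n ∧ (j : ℕ) < n
  · rw [dif_pos hij, CStarMatrix.mul_apply]
    refine Fintype.sum_of_injective (Fin.castLE h) (Fin.castLE_injective h) _ _ ?_ ?_
    · intro k hk
      have : ¬ (k : ℕ) < n := fun hkn => hk ⟨⟨k, hkn⟩, Fin.ext rfl⟩
      rw [dif_neg (fun hc => this hc.2), zero_mul]
    · intro k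
      rw [dif_pos ⟨hij.1, k.2⟩, dif_pos ⟨k.2, hij.2⟩]
      rfl
  · rw [dif_neg hij]
    symm
    refine Finset.sum_eq_zero fun k _ => ?_
    by_cases hi : (i : ℕ) < n
    · rw [dif_neg (c := (k : ℕ) < n ∧ (j : ℕ) < n) (fun hc => hij ⟨hi, hc.2⟩), mul_zero]
    · rw [dif_neg (fun hc => hi hc.1), zero_mul]

/-- The corner embedding `M_n(A) → M_m(A)` as a ⋆-homomorphism. -/
def padHom (A : Type*) [CStarAlgebra A] {n m : ℕ} (h : n ≤ m) : Mat n A →⋆ₙₐ[ℂ] Mat m A where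
  toFun := pad m
  map_smul' c a := by
    ext i j
    simp only [pad_apply, CStarMatrix.smul_apply, MonoidHom.id_apply]
    split_ifs <;> simp
  map_zero' := by
    ext i j
    simp [pad_apply]
  map_add' a b := by
    ext i j
    simp only [pad_apply, CStarMatrix.add_apply]
    split_ifs <;> simp
  map_mul' := pad_mul h
  map_star' a := by
    ext i j
    simp only [pad_apply, CStarMatrix.star_apply]
    by_cases hij : (i : ℕ) < n ∧ (j : ℕ) < n
    · rw [dif_pos hij, dif_pos hij.symm]
    · rw [dif_neg hij, dif_neg (fun hc => hij hc.symm), star_zero]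

@[simp] lemma padHom_apply {n m : ℕ} (h : n ≤ m) (a : Mat n A) : padHom A h a = pad m a := rfl

lemma single_apply {A : Type*} (x : A) (i j : Fin 1) : single x i j = x := rfl

/-- The identification of `A` with `M_1(A)` as a ⋆-homomorphism. -/
def singleHom (A : Type*) [CStarAlgebra A] : A →⋆ₙₐ[ℂ] Mat 1 A where
  toFun := single
  map_smul' c a := by ext i j; rfl
  map_zero' := by ext i j; rfl
  map_add' a b := by ext i j; rfl
  map_mul' a b := by
    ext i j
    rw [CStarMatrix.mul_apply]
    simp [single_apply]
  map_star' a := by ext i j; rw [CStarMatrix.star_apply]; rfl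

lemma single_one : single (1 : A) = 1 := by
  ext i j
  rw [single_apply, Subsingleton.elim i j, CStarMatrix.one_apply_eq]

/-- The partial isometry in `M_{n+n}(A)` that moves the lower right corner to the upper left one. -/
def shiftMat (A : Type*) [CStarAlgebra A] (n : ℕ) : Mat (n + n) A :=
  CStarMatrix.ofMatrix fun i j => if (j : ℕ) = i + n then 1 else 0

lemma shiftMat_apply (n : ℕ) (i j : Fin (n + n)) :
    shiftMat A n i j = if (j : ℕ) = i + n then 1 else 0 := rfl

lemma shiftMat_mul_star (n : ℕ) : shiftMat A n * star (shiftMat A n) = pad (n + n) (1 : Mat n A) := by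
  ext i j
  rw [CStarMatrix.mul_apply]
  simp only [CStarMatrix.star_apply, shiftMat_apply, pad_apply]
  by_cases hi : (i : ℕ) < n
  · rw [Finset.sum_eq_single (⟨i + n, by lia⟩ : Fin (n + n))]
    · by_cases hij : (i : ℕ) = j
      · have : i = j := Fin.ext hij
        subst this
        simp [hi]
      · rw [if_pos rfl, if_neg (by simpa using hij), star_zero, mul_zero]
        split_ifs with h
        · rw [CStarMatrix.one_apply_ne]
          simpa using hij
        · rfl
    · intro k _ hk
      rw [if_neg (fun hc => hk (Fin.ext hc)), zero_mul]
    · simp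
  · rw [dif_neg (fun hc => hi hc.1)]
    refine Finset.sum_eq_zero fun k _ => ?_
    rw [if_neg (by lia), zero_mul]

lemma shiftMat_mul_pad (n : ℕ) (a : Mat n A) : shiftMat A n * pad (n + n) a = 0 := by
  ext i j
  rw [CStarMatrix.mul_apply]
  simp only [shiftMat_apply, pad_apply, CStarMatrix.zero_apply]
  refine Finset.sum_eq_zero fun k _ => ?_
  by_cases hk : (k : ℕ) = i + n
  · rw [dif_neg (by lia), mul_zero]
  · rw [if_neg hk, zero_mul]

lemma one_eq_sum_single (n : ℕ) : (1 : Mat (n + 1) A)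
    = ∑ i : Fin (n + 1), CStarMatrix.ofMatrix (Matrix.single i i (1 : A)) := by
  ext i j
  have : (∑ k : Fin (n + 1), CStarMatrix.ofMatrix (Matrix.single k k (1 : A)))
      = CStarMatrix.ofMatrix (∑ k : Fin (n + 1), Matrix.single k k (1 : A)) := rfl
  rw [this, Matrix.sum_single_one]
  rfl

end MatrixMaps

namespace IsQuasitrace

lemma comp {B D : Type*} [CStarAlgebra B] [CStarAlgebra D] {T : D → ℂ} (h : IsQuasitrace T)
    (θ : B →⋆ₙₐ[ℂ] D) : IsQuasitrace fun x => T (θ x) where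
  nonneg x := by rw [map_mul, map_star]; exact h.nonneg _
  tracial x := by simp only [map_mul, map_star]; exact h.tracial _
  map_add S hS x hx y hy := by
    rw [_root_.map_add]
    refine h.map_add (S.map θ) ?_ _ ⟨x, hx, rfl⟩ _ ⟨y, hy, rfl⟩
    rintro _ ⟨u, hu, rfl⟩ _ ⟨v, hv, rfl⟩
    have := congrArg θ (hS u hu v hv)
    rwa [map_mul, map_mul] at this
  map_smul S hS c x hx := by
    rw [_root_.map_smul]
    refine h.map_smul (S.map θ) ?_ c _ ⟨x, hx, rfl⟩
    rintro _ ⟨u, hu, rfl⟩ _ ⟨v, hv, rfl⟩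
    have := congrArg θ (hS u hu v hv)
    rwa [map_mul, map_mul] at this
  map_add_I_smul a b ha hb := by
    rw [_root_.map_add, _root_.map_smul]
    exact h.map_add_I_smul _ _ (ha.map θ) (hb.map θ)

variable {B D : Type*} [CStarAlgebra B] [PartialOrder B] [StarOrderedRing B]
  [CStarAlgebra D] [PartialOrder D] [StarOrderedRing D] {T : D → ℂ}

/-- If the corner `θ(B)` of `D` has room for a second, orthogonal copy of itself, then `a + b` is
equivalent to a two by two matrix with diagonal `a`, `b`, which is at most
`diag ((1 + s) a, (1 + s⁻¹) b)`. -/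
lemma re_add_le_of_corner (h : IsQuasitrace T) (θ : B →⋆ₙₐ[ℂ] D) (V : D)
    (hV : ∀ x, V * θ x = 0) (hVV : ∀ x, V * star V * θ x = θ x) {a b : B} (ha : 0 ≤ a)
    (hb : 0 ≤ b) {s : ℝ} (hs : 0 < s) :
    (T (θ (a + b))).re ≤ (1 + s) * (T (θ a)).re + (1 + s⁻¹) * (T (θ b)).re := by
  set α := θ (CFC.sqrt a)
  set β := θ (CFC.sqrt b)
  have hα : star α = α := by
    simp only [α]; rw [← map_star, (CFC.sqrt_nonneg a).isSelfAdjoint.star_eq]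
  have hβ : star β = β := by
    simp only [β]; rw [← map_star, (CFC.sqrt_nonneg b).isSelfAdjoint.star_eq]
  have hαα : α * α = θ a := by
    simp only [α]; rw [← map_mul, CFC.sqrt_mul_sqrt_self a ha]
  have hββ : β * β = θ b := by
    simp only [β]; rw [← map_mul, CFC.sqrt_mul_sqrt_self b hb]
  have hVα : V * α = 0 := hV _
  have hαV : α * star V = 0 := by
    have := congrArg star hVα
    rwa [star_mul, hα, star_zero] at this
  have hVVβ : V * star V * β = β := hVV _
  set z := β * V
  have hzz : z * star z = θ b := by
    simp only [z]
    rw [star_mul, hβ, mul_assoc, ← mul_assoc V, hVVβ, hββ]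
  have hzα : z * α = 0 := by simp only [z]; rw [mul_assoc, hVα, mul_zero]
  have hαz : α * star z = 0 := by
    simp only [z]; rw [star_mul, hβ, ← mul_assoc, hαV, zero_mul]
  have e1 : (α + z) * star (α + z) = θ (a + b) := by
    rw [star_add, hα, add_mul, mul_add, mul_add, hαα, hαz, hzα, hzz, _root_.map_add]; abel
  have e2 : star (α + z) * (α + z) ≤ (1 + s) • (α * α) + (1 + s⁻¹) • (star z * z) := by
    set r := √s
    have hr : r * r = s := Real.mul_self_sqrt hs.le
    have hr0 : r ≠ 0 := (Real.sqrt_pos.2 hs).ne'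
    have hpos := star_mul_self_nonneg (r • α - r⁻¹ • z)
    have e3 : star (r • α - r⁻¹ • z) * (r • α - r⁻¹ • z)
        = (1 + s) • (α * α) + (1 + s⁻¹) • (star z * z) - star (α + z) * (α + z) := by
      simp only [star_sub, star_add, star_smul, star_trivial, hα, sub_mul, mul_sub, add_mul,
        mul_add, smul_mul_smul_comm, hr, add_smul, one_smul]
      rw [mul_inv_cancel₀ hr0, inv_mul_cancel₀ hr0, ← mul_inv, hr, one_smul, one_smul]
      abel
    rw [e3] at hpos
    exact sub_nonneg.1 hpos
  have nα : IsSelfAdjoint (α * α) := by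
    have := IsSelfAdjoint.star_mul_self α
    rwa [hα] at this
  have nz : IsSelfAdjoint (star z * z) := .star_mul_self z
  have hcomm : Commute ((1 + s) • (α * α)) ((1 + s⁻¹) • (star z * z)) := by
    refine (Commute.smul_left ?_ _).smul_right _
    have p1 : α * α * (star z * z) = 0 := by
      rw [mul_assoc, ← mul_assoc α (star z), hαz, zero_mul, mul_zero]
    have p2 : star z * z * (α * α) = 0 := by
      rw [mul_assoc, ← mul_assoc z α, hzα, zero_mul, mul_zero]
    rw [commute_iff_eq, p1, p2]
  have e4 := h.re_mono (.star_mul_self (α + z))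
    (.add (.smul (.all _) nα) (.smul (.all _) nz)) e2
  rw [h.tracial, e1, h.re_add_of_commute (.smul (.all _) nα) (.smul (.all _) nz) hcomm,
    h.re_smul nα, h.re_smul nz, h.tracial, hzz, hαα] at e4
  exact e4

end IsQuasitrace

namespace IsMatrixExtension

variable {A : Type*} [CStarAlgebra A] [PartialOrder A] [StarOrderedRing A] {τ : A → ℂ}
  {T : ∀ n, Mat n A → ℂ}

lemma orderedQuasitrace (h : IsMatrixExtension τ T) (n : ℕ) :
    OrderedQuasitrace fun a : Mat n A => (T n a).re where
  mono a b ha hb hab := (h.isQuasitrace n).re_mono ha hb hab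
  tracial x := by rw [(h.isQuasitrace n).tracial]
  smul c a ha := (h.isQuasitrace n).re_smul ha c
  add_smul_one a c ha := (h.isQuasitrace n).re_add_smul_one ha c
  map_cfc_add k f g _ _ _ := (h.isQuasitrace n).re_add_of_commute (cfc_predicate _ _)
    (cfc_predicate _ _) (cfc_commute_cfc _ _ _)
  add_le a b s ha hb hs := by
    have := (h.isQuasitrace (n + n)).re_add_le_of_corner (padHom A (Nat.le_add_right n n))
      (shiftMat A n) (fun x => shiftMat_mul_pad n x) (fun x => by
        rw [shiftMat_mul_star, padHom_apply, ← pad_mul (Nat.le_add_right n n), one_mul]) ha hb hs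
    simpa only [padHom_apply, h.map_pad n (n + n) (Nat.le_add_right n n)] using this

lemma one_re_le (h : IsMatrixExtension τ T) (hτ : τ 1 = 1) (n : ℕ) : (T n 1).re ≤ n := by
  cases n with
  | zero =>
    rw [show (1 : Mat 0 A) = 0 by ext i; exact i.elim0, (h.isQuasitrace 0).zero]
    simp
  | succ n =>
    set e : Fin (n + 1) → Mat (n + 1) A :=
      fun i => CStarMatrix.ofMatrix (Matrix.single i i (1 : A))
    have hst : ∀ i j : Fin (n + 1), star (CStarMatrix.ofMatrix (Matrix.single i j (1 : A)))
        = CStarMatrix.ofMatrix (Matrix.single j i (1 : A)) := by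
      intro i j
      have := Matrix.conjTranspose_single i j (1 : A)
      rw [star_one] at this
      exact this
    have hmul : ∀ i j k : Fin (n + 1), CStarMatrix.ofMatrix (Matrix.single i j (1 : A)) *
        CStarMatrix.ofMatrix (Matrix.single j k (1 : A))
        = CStarMatrix.ofMatrix (Matrix.single i k (1 : A)) := by
      intro i j k
      have := Matrix.single_mul_single_same (1 : A) i j k (1 : A)
      rw [mul_one] at this
      exact this
    have he : ∀ i, 0 ≤ e i := fun i => by
      have := star_mul_self_nonneg (e i)
      rwa [hst, hmul] at this
    have hte : ∀ i, (T (n + 1) (e i)).re = 1 := by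
      intro i
      have h1 := (h.isQuasitrace (n + 1)).tracial (CStarMatrix.ofMatrix (Matrix.single 0 i (1 : A)))
      rw [hst, hmul, hmul] at h1
      have h2 : pad (n + 1) (single (1 : A)) = CStarMatrix.ofMatrix (Matrix.single 0 0 (1 : A)) := by
        ext k l
        simp only [pad_apply, single_apply, CStarMatrix.ofMatrix_apply, Matrix.single_apply,
          Fin.ext_iff, Fin.val_zero]
        split_ifs <;> first | rfl | lia
      rw [← h2, h.map_pad 1 (n + 1) (by lia), h.map_single, hτ] at h1
      simp [e, h1]
    have horth : ∀ i j, i ≠ j → e i * e j = 0 := fun i j hij =>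
      Matrix.single_mul_single_of_ne _ _ _ _ hij _
    have := (h.orderedQuasitrace (n + 1)).sum_of_pairwise Finset.univ e (fun _ => 1) he
      (fun _ => zero_le_one) horth
    have h1 : (1 : Mat (n + 1) A) = ∑ i, (1 : ℝ) • e i := by
      simp only [one_smul]; exact one_eq_sum_single n
    rw [h1]
    exact this.trans_le (by simp [hte])

end IsMatrixExtension

/-! ### The quasitrace determined by its values on self-adjoint elements -/

open ComplexStarModule in
lemma commute_parts {B : Type*} [CStarAlgebra B] {x y : B} (hxy : Commute x y) (hxy' : Commute x (star y)) :
    Commute (ℜ x : B) (ℜ y : B) ∧ Commute (ℑ x : B) (ℑ y : B) ∧ Commute (ℜ x : B) (ℑ y : B) := by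
  have h1 : Commute (star x) (star y) := by
    have := congrArg star hxy.eq
    rw [star_mul, star_mul] at this
    exact this.symm
  have h2 : Commute (star x) y := by
    have := congrArg star hxy'.eq
    rw [star_mul, star_mul, star_star] at this
    exact this.symm
  have hr : ∀ z : B, (ℜ z : B) = (2⁻¹ : ℝ) • (z + star z) := fun z => by simp [realPart_apply_coe]
  have hi : ∀ z : B, (ℑ z : B) = -Complex.I • (2⁻¹ : ℝ) • (z - star z) := fun z => by
    simp [imaginaryPart_apply_coe]
  simp only [hr, hi]
  refine ⟨?_, ?_, ?_⟩
  · exact (((hxy.add_right hxy').add_left (h2.add_right h1)).smul_left _).smul_right _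
  · exact ((((((hxy.sub_right hxy').sub_left (h2.sub_right h1)).smul_left _).smul_right _).smul_left
      _).smul_right _)
  · exact (((((hxy.sub_right hxy').add_left (h2.sub_right h1)).smul_left _).smul_right _).smul_right
      _)

namespace OrderedQuasitrace

open ComplexStarModule

variable {B : Type*} [CStarAlgebra B] [PartialOrder B] [StarOrderedRing B] {t : B → ℝ}

/-- The complex-valued function determined by its values on self-adjoint elements. -/
noncomputable def complexify (t : B → ℝ) (x : B) : ℂ :=
  t (ℜ x : B) + Complex.I * t (ℑ x : B)

lemma complexify_of_isSelfAdjoint (ht : OrderedQuasitrace t) {a : B} (ha : IsSelfAdjoint a) :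
    complexify t a = t a := by
  simp [complexify, ha.coe_realPart, ha.imaginaryPart, ht.zero]

lemma isQuasitrace (ht : OrderedQuasitrace t) : IsQuasitrace (complexify t) where
  nonneg x := by
    rw [ht.complexify_of_isSelfAdjoint (.star_mul_self x)]
    exact_mod_cast ht.nonneg (star_mul_self_nonneg x)
  tracial x := by
    rw [ht.complexify_of_isSelfAdjoint (.star_mul_self x),
      ht.complexify_of_isSelfAdjoint (.mul_star_self x), ht.tracial]
  map_add S hS x hx y hy := by
    obtain ⟨h1, h2, -⟩ := commute_parts (hS x hx y hy) (hS x hx _ (star_mem hy))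
    simp only [complexify, _root_.map_add, AddSubgroup.coe_add]
    rw [ht.add_of_commute (ℜ x).2 (ℜ y).2 h1, ht.add_of_commute (ℑ x).2 (ℑ y).2 h2]
    push_cast
    ring
  map_smul S hS c x hx := by
    obtain ⟨-, -, h3⟩ := commute_parts (hS x hx x hx) (hS x hx _ (star_mem hx))
    have hr := (ℜ x).2
    have hi := (ℑ x).2
    simp only [complexify, realPart_smul, imaginaryPart_smul, AddSubgroupClass.coe_sub,
      AddSubgroup.coe_add, selfAdjoint.val_smul]
    rw [sub_eq_add_neg, ← neg_smul,
      ht.add_of_commute (.smul (.all _) hr) (.smul (.all _) hi) ((h3.smul_left _).smul_right _),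
      ht.add_of_commute (.smul (.all _) hi) (.smul (.all _) hr) ((h3.symm.smul_left _).smul_right _),
      ht.smul _ _ hr, ht.smul _ _ hi, ht.smul _ _ hr, ht.smul _ _ hi]
    apply Complex.ext <;> simp [sub_eq_add_neg]
  map_add_I_smul a b ha hb := by
    rw [ht.complexify_of_isSelfAdjoint ha, ht.complexify_of_isSelfAdjoint hb]
    simp [complexify, ha.coe_realPart, hb.coe_realPart, ha.imaginaryPart, hb.imaginaryPart,
      realPart_I_smul, imaginaryPart_I_smul]

end OrderedQuasitrace

/-! ### Asymptotic representatives -/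

/-- A relation `R x a` between sequences `x j ∈ B j` and elements `a ∈ D`, saying that `x` is a sequence of
asymptotic representatives of `a`. The conditions mean that `R` comes from an embedding of `D` into
the quotient of the bounded sequences by the null sequences. -/
structure IsAsympRep {B : ℕ → Type*} [∀ j, CStarAlgebra (B j)] {D : Type*} [CStarAlgebra D]
    (R : (∀ j, B j) → D → Prop) : Prop where
  one : R (fun _ => 1) 1
  add : ∀ {x y a b}, R x a → R y b → R (fun j => x j + y j) (a + b)
  mul : ∀ {x y a b}, R x a → R y b → R (fun j => x j * y j) (a * b)
  star : ∀ {x a}, R x a → R (fun j => star (x j)) (star a)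
  smul : ∀ (c : ℂ) {x a}, R x a → R (fun j => c • x j) (c • a)
  exists_rep : ∀ a, ∃ x, R x a
  bounded : ∀ {x a}, R x a → ∃ C, ∀ᶠ j in atTop, ‖x j‖ ≤ C
  tendsto_zero : ∀ {x}, R x 0 → Tendsto (fun j => ‖x j‖) atTop (𝓝 0)
  eq_zero : ∀ {a}, R (fun _ => 0) a → a = 0
  of_approx : ∀ {x a}, (∀ ε > 0, ∃ y b, R y b ∧ (∀ᶠ j in atTop, ‖x j - y j‖ ≤ ε) ∧ ‖a - b‖ ≤ ε) →
    R x a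

namespace IsAsympRep

variable {B : ℕ → Type*} [∀ j, CStarAlgebra (B j)] {D : Type*} [CStarAlgebra D]
  {R : (∀ j, B j) → D → Prop} {x y : ∀ j, B j} {a b : D}

lemma real_smul (hR : IsAsympRep R) (c : ℝ) (hx : R x a) : R (fun j => c • x j) (c • a) := by
  have := hR.smul (c : ℂ) hx
  simpa only [Complex.coe_smul] using this

lemma neg (hR : IsAsympRep R) (hx : R x a) : R (fun j => -x j) (-a) := by
  have := hR.smul (-1) hx
  simpa only [neg_smul, one_smul] using this

lemma sub (hR : IsAsympRep R) (hx : R x a) (hy : R y b) : R (fun j => x j - y j) (a - b) := by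
  have := hR.add hx (hR.neg hy)
  simpa only [← sub_eq_add_neg] using this

lemma zero (hR : IsAsympRep R) : R (fun _ => 0) (0 : D) := by
  have := hR.smul 0 hR.one
  simpa only [zero_smul] using this

lemma tendsto_sub (hR : IsAsympRep R) (hx : R x a) (hy : R y a) :
    Tendsto (fun j => ‖x j - y j‖) atTop (𝓝 0) := by
  have := hR.sub hx hy
  rw [sub_self] at this
  exact hR.tendsto_zero this

lemma congr' (hR : IsAsympRep R) (hx : R x a) (h : Tendsto (fun j => ‖x j - y j‖) atTop (𝓝 0)) :
    R y a := by
  refine hR.of_approx fun ε hε => ⟨x, a, hx, ?_, by simpa using hε.le⟩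
  filter_upwards [h.eventually_lt_const hε] with j hj
  rw [norm_sub_rev]
  exact hj.le

lemma unique (hR : IsAsympRep R) (hx : R x a) (hy : R x b) : a = b := by
  have := hR.sub hx hy
  simp only [sub_self] at this
  exact sub_eq_zero.1 (hR.eq_zero this)

lemma pow (hR : IsAsympRep R) (hx : R x a) (n : ℕ) : R (fun j => x j ^ n) (a ^ n) := by
  induction n with
  | zero => simpa only [pow_zero] using hR.one
  | succ n ih => simpa only [pow_succ] using hR.mul ih hx

lemma aeval (hR : IsAsympRep R) (hx : R x a) (p : Polynomial ℝ) :
    R (fun j => Polynomial.aeval (x j) p) (Polynomial.aeval a p) := by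
  induction p using Polynomial.induction_on' with
  | add p q hp hq => simpa only [map_add] using hR.add hp hq
  | monomial n c =>
    simp only [Polynomial.aeval_monomial, Algebra.algebraMap_eq_smul_one, smul_mul_assoc, one_mul]
    exact hR.real_smul c (hR.pow hx n)

lemma exists_isSelfAdjoint_rep (hR : IsAsympRep R) (ha : IsSelfAdjoint a) :
    ∃ x, R x a ∧ ∀ j, IsSelfAdjoint (x j) := by
  obtain ⟨x, hx⟩ := hR.exists_rep a
  refine ⟨fun j => (2⁻¹ : ℝ) • (x j + Star.star (x j)), ?_, fun j =>
    .smul (.all _) (IsSelfAdjoint.add_star_self _)⟩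
  have := hR.real_smul (2⁻¹ : ℝ) (hR.add hx (hR.star hx))
  rwa [ha.star_eq, ← two_smul ℝ a, smul_smul, inv_mul_cancel₀ two_ne_zero, one_smul] at this

lemma norm_cfc_sub_aeval_le {E : Type*} [CStarAlgebra E] {f : ℝ → ℝ} (hf : Continuous f)
    {p : Polynomial ℝ} {M ε : ℝ} (hp : ∀ t ∈ Set.Icc (-M) M, |p.eval t - f t| < ε) {y : E}
    (hy : IsSelfAdjoint y) (hyM : ‖y‖ ≤ M) : ‖_root_.cfc f y - Polynomial.aeval y p‖ ≤ ε := by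
  have hε : 0 ≤ ε := by
    have hM : 0 ≤ M := (norm_nonneg y).trans hyM
    exact (abs_nonneg _).trans (hp 0 ⟨by linarith, hM⟩).le
  rw [← cfc_polynomial p y, ← cfc_sub _ _ y]
  refine norm_cfc_le hε fun t ht => ?_
  have h1 := spectrum.norm_le_norm_mul_of_mem ht
  have h2 : |t| ≤ M := by
    refine h1.trans (le_trans ?_ hyM)
    nlinarith [norm_nonneg y, IsQuasitrace.norm_one_le (B := E)]
  rw [Real.norm_eq_abs, abs_sub_comm]
  exact (hp t (abs_le.1 h2)).le

/-- Asymptotic representatives are compatible with the continuous functional calculus, by polynomial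
approximation. -/
lemma cfc (hR : IsAsympRep R) (hx : R x a) (hxs : ∀ j, IsSelfAdjoint (x j)) (ha : IsSelfAdjoint a)
    {f : ℝ → ℝ} (hf : Continuous f) : R (fun j => cfc f (x j)) (cfc f a) := by
  refine hR.of_approx fun ε hε => ?_
  obtain ⟨C, hC⟩ := hR.bounded hx
  set M := max C ‖a‖
  obtain ⟨p, hp⟩ := exists_polynomial_near_of_continuousOn (-M) M f hf.continuousOn ε hε
  refine ⟨_, _, hR.aeval hx p, ?_, norm_cfc_sub_aeval_le hf hp ha (le_max_right _ _)⟩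
  filter_upwards [hC] with j hj
  exact norm_cfc_sub_aeval_le hf hp (hxs j) (hj.trans (le_max_left _ _))

lemma sum (hR : IsAsympRep R) {ι : Type*} (s : Finset ι) {x : ι → ∀ j, B j} {a : ι → D}
    (h : ∀ i, R (x i) (a i)) : R (fun j => ∑ i ∈ s, x i j) (∑ i ∈ s, a i) := by
  classical
  induction s using Finset.induction_on with
  | empty => simpa using hR.zero
  | insert i s his ih => simpa only [Finset.sum_insert his] using hR.add (h i) ih

end IsAsympRep

/-! ### Matrices of asymptotic representatives -/

section Matrix

/-- Entrywise asymptotic representatives of a matrix. -/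
def matRel {B : ℕ → Type*} {D : Type*} (R : (∀ j, B j) → D → Prop) (n : ℕ)
    (X : ∀ j, Mat n (B j)) (a : Mat n D) : Prop :=
  ∀ p q, R (fun j => X j p q) (a p q)

lemma matRel.pad {B : ℕ → Type*} [∀ j, CStarAlgebra (B j)] {D : Type*} [CStarAlgebra D]
    {R : (∀ j, B j) → D → Prop} (hR : IsAsympRep R) {n : ℕ} (m : ℕ) {X : ∀ j, Mat n (B j)}
    {a : Mat n D} (h : matRel R n X a) : matRel R m (fun j => pad m (X j)) (pad m a) := by
  intro p q
  simp only [pad_apply]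
  split_ifs with hpq
  · exact h _ _
  · exact hR.zero

lemma norm_le_sum_entries {A : Type*} [CStarAlgebra A] [PartialOrder A] [StarOrderedRing A] {n : ℕ}
    (M : Mat n A) : ‖M‖ ≤ ∑ j, ∑ i, ‖M i j‖ := by
  rw [CStarMatrix.norm_def]
  refine (CStarMatrix.toCLM M).opNorm_le_bound (by positivity) fun v => ?_
  simp only [CStarMatrix.toCLM_apply_eq_sum, Finset.sum_mul]
  apply WithCStarModule.pi_norm_le_sum_norm _ |>.trans
  gcongr with i _
  change ‖∑ j, v j * M j i‖ ≤ _
  apply norm_sum_le _ _ |>.trans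
  gcongr with j _
  apply norm_mul_le _ _ |>.trans
  rw [mul_comm]
  gcongr
  exact WithCStarModule.norm_apply_le_norm v j

variable {B : ℕ → Type*} [∀ j, CStarAlgebra (B j)] [∀ j, PartialOrder (B j)]
  [∀ j, StarOrderedRing (B j)] {D : Type*} [CStarAlgebra D] [PartialOrder D] [StarOrderedRing D]
  {R : (∀ j, B j) → D → Prop}

lemma tendsto_norm_of_entries {n : ℕ} {ι : Type*} {l : Filter ι} {E : ι → Type*}
    [∀ j, CStarAlgebra (E j)] [∀ j, PartialOrder (E j)] [∀ j, StarOrderedRing (E j)]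
    (X : ∀ j, Mat n (E j))
    (h : ∀ p q, Tendsto (fun j => ‖X j p q‖) l (𝓝 0)) : Tendsto (fun j => ‖X j‖) l (𝓝 0) := by
  have h1 : Tendsto (fun j => ∑ q, ∑ p, ‖X j p q‖) l (𝓝 (∑ _q : Fin n, ∑ _p : Fin n, 0)) :=
    tendsto_finsetSum _ fun q _ => tendsto_finsetSum _ fun p _ => h p q
  simp only [Finset.sum_const_zero] at h1
  exact squeeze_zero (fun _ => norm_nonneg _) (fun j => norm_le_sum_entries _) h1

lemma IsAsympRep.matRel (hR : IsAsympRep R) (n : ℕ) : IsAsympRep (matRel R n) where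
  one p q := by
    by_cases h : p = q
    · subst h
      simpa only [CStarMatrix.one_apply_eq] using hR.one
    · simpa only [CStarMatrix.one_apply_ne h] using hR.zero
  add hx hy p q := hR.add (hx p q) (hy p q)
  mul {x y a b} hx hy p q := by
    simp only [CStarMatrix.mul_apply]
    exact hR.sum _ fun k => hR.mul (hx p k) (hy k q)
  star {x a} hx p q := by
    simp only [CStarMatrix.star_apply]
    exact hR.star (hx q p)
  smul c {x a} hx p q := hR.smul c (hx p q)
  exists_rep a := by
    choose x hx using fun p q => hR.exists_rep (a p q)
    exact ⟨fun j => CStarMatrix.ofMatrix fun p q => x p q j, hx⟩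
  bounded {X a} hX := by
    choose C hC using fun p q => hR.bounded (hX p q)
    refine ⟨∑ q, ∑ p, C p q, ?_⟩
    filter_upwards [eventually_all.2 fun p => eventually_all.2 fun q => hC p q] with j hj
    exact (norm_le_sum_entries _).trans (Finset.sum_le_sum fun q _ => Finset.sum_le_sum
      fun p _ => hj p q)
  tendsto_zero {X} hX := tendsto_norm_of_entries X fun p q => hR.tendsto_zero (hX p q)
  eq_zero {a} h := by
    ext p q
    exact hR.eq_zero (h p q)
  of_approx {X a} h p q := by
    refine hR.of_approx fun ε hε => ?_
    obtain ⟨Y, b, hY, h1, h2⟩ := h ε hε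
    refine ⟨_, _, hY p q, ?_, ?_⟩
    · filter_upwards [h1] with j hj
      exact le_trans (CStarMatrix.norm_entry_le_norm (M := X j - Y j)) hj
    · exact le_trans (CStarMatrix.norm_entry_le_norm (M := a - b)) h2

end Matrix

/-! ### Representatives in an inductive limit -/

section Limit

variable {A : ℕ → Type*} [∀ i, CStarAlgebra (A i)] {L : Type*} [CStarAlgebra L]

/-- `z` is eventually a coherent sequence for the connecting maps, with limit `c`. -/
def Thread (φ : ∀ i, A i →⋆ₐ[ℂ] A (i + 1)) (ψ : ∀ i, A i →⋆ₐ[ℂ] L) (z : ∀ j, A j) (c : L) : Prop :=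
  ∃ i, ∀ j, i ≤ j → z (j + 1) = φ j (z j) ∧ ψ j (z j) = c

/-- `x` is, up to a null sequence, a limit of coherent sequences, whose limits tend to `a`. -/
def limRel (φ : ∀ i, A i →⋆ₐ[ℂ] A (i + 1)) (ψ : ∀ i, A i →⋆ₐ[ℂ] L) (x : ∀ j, A j) (a : L) : Prop :=
  ∀ ε > 0, ∃ z c, Thread φ ψ z c ∧ (∀ᶠ j in atTop, ‖x j - z j‖ ≤ ε) ∧ ‖a - c‖ ≤ ε

variable {φ : ∀ i, A i →⋆ₐ[ℂ] A (i + 1)} {ψ : ∀ i, A i →⋆ₐ[ℂ] L}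

namespace Thread

variable {z w : ∀ j, A j} {c d : L}

lemma limRel (h : Thread φ ψ z c) : limRel φ ψ z c := fun ε hε =>
  ⟨z, c, h, by simp [hε.le], by simp [hε.le]⟩

lemma add (h : Thread φ ψ z c) (h' : Thread φ ψ w d) :
    Thread φ ψ (fun j => z j + w j) (c + d) := by
  obtain ⟨i, hi⟩ := h
  obtain ⟨i', hi'⟩ := h'
  refine ⟨max i i', fun j hj => ?_⟩
  obtain ⟨h1, h2⟩ := hi j (le_of_max_le_left hj)
  obtain ⟨h3, h4⟩ := hi' j (le_of_max_le_right hj)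
  dsimp only
  rw [map_add, map_add, h1, h2, h3, h4]
  exact ⟨rfl, rfl⟩

lemma mul (h : Thread φ ψ z c) (h' : Thread φ ψ w d) :
    Thread φ ψ (fun j => z j * w j) (c * d) := by
  obtain ⟨i, hi⟩ := h
  obtain ⟨i', hi'⟩ := h'
  refine ⟨max i i', fun j hj => ?_⟩
  obtain ⟨h1, h2⟩ := hi j (le_of_max_le_left hj)
  obtain ⟨h3, h4⟩ := hi' j (le_of_max_le_right hj)
  dsimp only
  rw [map_mul, map_mul, h1, h2, h3, h4]
  exact ⟨rfl, rfl⟩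

lemma star (h : Thread φ ψ z c) : Thread φ ψ (fun j => star (z j)) (star c) := by
  obtain ⟨i, hi⟩ := h
  refine ⟨i, fun j hj => ?_⟩
  obtain ⟨h1, h2⟩ := hi j hj
  dsimp only
  rw [map_star, map_star, h1, h2]
  exact ⟨rfl, rfl⟩

lemma smul (r : ℂ) (h : Thread φ ψ z c) : Thread φ ψ (fun j => r • z j) (r • c) := by
  obtain ⟨i, hi⟩ := h
  refine ⟨i, fun j hj => ?_⟩
  obtain ⟨h1, h2⟩ := hi j hj
  dsimp only
  rw [map_smul, map_smul, h1, h2]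
  exact ⟨rfl, rfl⟩

lemma one : Thread φ ψ (fun _ => 1) 1 := ⟨0, fun j _ => by simp⟩

lemma connect_eq {i : ℕ} (hi : ∀ j, i ≤ j → z (j + 1) = φ j (z j)) (k : ℕ) :
    connect φ i k (z i) = z (i + k) := by
  induction k with
  | zero => rfl
  | succ k ih =>
    change φ (i + k) (connect φ i k (z i)) = z (i + k + 1)
    rw [ih, hi (i + k) (by lia)]

lemma tendsto_norm (hlim : IsInductiveLimit φ ψ) (h : Thread φ ψ z c) :
    Tendsto (fun j => ‖z j‖) atTop (𝓝 ‖c‖) := by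
  obtain ⟨i, hi⟩ := h
  have h1 := hlim.tendsto_norm i (z i)
  rw [(hi i le_rfl).2] at h1
  simp only [connect_eq fun j hj => (hi j hj).1] at h1
  rw [← tendsto_add_atTop_iff_nat i]
  refine h1.congr fun k => ?_
  rw [add_comm]

lemma exists_of_apply (hlim : IsInductiveLimit φ ψ) (i : ℕ) (y : A i) :
    ∃ z, Thread φ ψ z (ψ i y) := by
  set f : ∀ j, i ≤ j → A j := fun j h => Nat.leRec (motive := fun j _ => A j) y (fun j _ x => φ j x) h
  have hf : ∀ j (h : i ≤ j), ψ j (f j h) = ψ i y := by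
    intro j h
    induction j, h using Nat.le_induction with
    | base => simp [f]
    | succ j h ih =>
      rw [← ih]
      simp only [f, Nat.leRec_succ _ _ h]
      rw [← hlim.comp_eq j]
      rfl
  refine ⟨fun j => if h : i ≤ j then f j h else 0, i, fun j hj => ?_⟩
  simp only [dif_pos hj, dif_pos (hj.trans (Nat.le_succ j))]
  exact ⟨by simp only [f, Nat.leRec_succ _ _ hj], hf j hj⟩

end Thread

lemma limRel.of_approx {x : ∀ j, A j} {a : L} (h : ∀ ε > 0, ∃ y b, limRel φ ψ y b ∧
    (∀ᶠ j in atTop, ‖x j - y j‖ ≤ ε) ∧ ‖a - b‖ ≤ ε) : limRel φ ψ x a := by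
  intro ε hε
  obtain ⟨y, b, hy, h1, h2⟩ := h (ε / 2) (by positivity)
  obtain ⟨z, c, hz, h3, h4⟩ := hy (ε / 2) (by positivity)
  refine ⟨z, c, hz, ?_, ?_⟩
  · filter_upwards [h1, h3] with j h1 h3
    linarith [norm_sub_le_norm_sub_add_norm_sub (x j) (y j) (z j)]
  · linarith [norm_sub_le_norm_sub_add_norm_sub a b c]

lemma limRel.bounded (hlim : IsInductiveLimit φ ψ) {x : ∀ j, A j} {a : L} (hx : limRel φ ψ x a)
    {ε : ℝ} (hε : 0 < ε) : ∀ᶠ j in atTop, ‖x j‖ ≤ ‖a‖ + ε := by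
  obtain ⟨z, c, hz, h1, h2⟩ := hx (ε / 3) (by positivity)
  have h3 := (hz.tendsto_norm hlim).eventually_lt_const (lt_add_of_pos_right ‖c‖
    (show 0 < ε / 3 by positivity))
  filter_upwards [h1, h3] with j h1 h3
  have h4 := norm_le_norm_add_norm_sub' (x j) (z j)
  have h5 := norm_le_norm_add_norm_sub' c a
  rw [norm_sub_rev] at h5
  linarith

/-- Every element of the limit has asymptotic representatives: a diagonal sequence through coherent
sequences whose limits converge to it. -/
lemma limRel.exists_rep (hlim : IsInductiveLimit φ ψ) (a : L) : ∃ x, limRel φ ψ x a := by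
  have h1 : ∀ m : ℕ, ∃ z c, Thread φ ψ z c ∧ ‖a - c‖ < 1 / ((m : ℝ) + 1) := by
    intro m
    obtain ⟨c, hc, hca⟩ := hlim.dense.exists_dist_lt a (ε := 1 / ((m : ℝ) + 1)) (by positivity)
    obtain ⟨i, y, rfl⟩ := Set.mem_iUnion.1 hc
    obtain ⟨z, hz⟩ := Thread.exists_of_apply hlim i y
    exact ⟨z, _, hz, by rwa [dist_eq_norm] at hca⟩
  choose z c hz hc using h1
  classical
  let P : ℕ → ℕ → Prop := fun j m => ∀ m' ≤ m, ‖z m' j - z m j‖ ≤ 2 / ((m' : ℝ) + 1)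
  have hP : ∀ m, ∀ᶠ j in atTop, P j m := by
    intro m
    have h2 : ∀ m' ∈ Finset.range (m + 1), ∀ᶠ j in atTop, ‖z m' j - z m j‖ ≤ 2 / ((m' : ℝ) + 1) := by
      intro m' hm'
      have hle : m' ≤ m := Nat.lt_succ_iff.1 (Finset.mem_range.1 hm')
      have h3 := (((hz m').add ((hz m).smul (-1))).tendsto_norm hlim)
      simp only [neg_smul, one_smul, ← sub_eq_add_neg] at h3
      have h4 : ‖c m' - c m‖ < 2 / ((m' : ℝ) + 1) := by
        have h5 := norm_sub_le_norm_sub_add_norm_sub (c m') a (c m)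
        rw [norm_sub_rev (c m') a] at h5
        have h6 : 1 / ((m : ℝ) + 1) ≤ 1 / ((m' : ℝ) + 1) := by gcongr
        have h7 : 2 / ((m' : ℝ) + 1) = 1 / ((m' : ℝ) + 1) + 1 / ((m' : ℝ) + 1) := by ring
        linarith [hc m, hc m']
      filter_upwards [h3.eventually_lt_const h4] with j hj using hj.le
    filter_upwards [(Filter.eventually_all_finset _).2 h2] with j hj m' hm'
    exact hj m' (Finset.mem_range.2 (Nat.lt_succ_of_le hm'))
  refine ⟨fun j => z (Nat.findGreatest (P j) j) j, fun ε hε => ?_⟩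
  obtain ⟨m, hm⟩ := exists_nat_gt (2 / ε)
  have hm' : 2 / ((m : ℝ) + 1) ≤ ε := by
    rw [div_lt_iff₀ hε] at hm
    rw [div_le_iff₀ (by positivity)]
    nlinarith
  refine ⟨z m, c m, hz m, ?_, ?_⟩
  · filter_upwards [hP m, eventually_ge_atTop m] with j hj hmj
    have h2 : P j (Nat.findGreatest (P j) j) := Nat.findGreatest_spec hmj hj
    have h3 := h2 m (Nat.le_findGreatest hmj hj)
    rw [norm_sub_rev]
    exact h3.trans hm'
  · refine (hc m).le.trans (le_trans ?_ hm')
    gcongr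
    norm_num

lemma norm_mul_sub_mul_le {E : Type*} [CStarAlgebra E] {p q r s : E} {δ C C' : ℝ}
    (h1 : ‖p - r‖ ≤ δ) (h2 : ‖q - s‖ ≤ δ) (h3 : ‖q‖ ≤ C) (h4 : ‖r‖ ≤ C') :
    ‖p * q - r * s‖ ≤ δ * C + C' * δ := by
  have hδ : 0 ≤ δ := (norm_nonneg _).trans h1
  have hC' : 0 ≤ C' := (norm_nonneg _).trans h4
  have e : p * q - r * s = (p - r) * q + r * (q - s) := by noncomm_ring
  rw [e]
  refine (norm_add_le _ _).trans ?_
  calc ‖(p - r) * q‖ + ‖r * (q - s)‖ ≤ ‖p - r‖ * ‖q‖ + ‖r‖ * ‖q - s‖ :=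
        add_le_add (norm_mul_le _ _) (norm_mul_le _ _)
    _ ≤ δ * C + C' * δ := by gcongr

lemma IsInductiveLimit.isAsympRep (hlim : IsInductiveLimit φ ψ) : IsAsympRep (limRel φ ψ) where
  one := Thread.one.limRel
  add {x y a b} hx hy ε hε := by
    obtain ⟨z, c, hz, h1, h2⟩ := hx (ε / 2) (by positivity)
    obtain ⟨w, d, hw, h3, h4⟩ := hy (ε / 2) (by positivity)
    refine ⟨_, _, hz.add hw, ?_, ?_⟩
    · filter_upwards [h1, h3] with j h1 h3
      rw [add_sub_add_comm]
      exact (norm_add_le _ _).trans (by linarith)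
    · rw [add_sub_add_comm]
      exact (norm_add_le _ _).trans (by linarith)
  mul {x y a b} hx hy ε hε := by
    set C := ‖a‖ + ‖b‖ + 3
    have hC : 0 < C := by positivity
    set δ := min 1 (ε / C)
    have hδ : 0 < δ := by positivity
    have hδ1 : δ ≤ 1 := min_le_left _ _
    have hδC : C * δ ≤ ε := by
      calc C * δ ≤ C * (ε / C) := by gcongr; exact min_le_right _ _
        _ = ε := by field_simp
    have hδC' : δ * (‖b‖ + 1) + (‖a‖ + 2) * δ ≤ ε := by
      simp only [C] at hδC; linarith
    obtain ⟨z, c, hz, h1, h2⟩ := hx δ hδ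
    obtain ⟨w, d, hw, h3, h4⟩ := hy δ hδ
    have hca : ‖c‖ ≤ ‖a‖ + 1 := by
      have := norm_le_norm_add_norm_sub' c a
      rw [norm_sub_rev] at this
      linarith
    refine ⟨_, _, hz.mul hw, ?_, (norm_mul_sub_mul_le h2 h4
      (by linarith : ‖b‖ ≤ ‖b‖ + 1) (by linarith : ‖c‖ ≤ ‖a‖ + 2)).trans hδC'⟩
    filter_upwards [h1, h3, limRel.bounded hlim hy one_pos,
      limRel.bounded hlim hz.limRel one_pos] with j h1 h3 h5 h6
    exact (norm_mul_sub_mul_le h1 h3 h5 (by linarith : ‖z j‖ ≤ ‖a‖ + 2)).trans hδC'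
  star {x a} hx ε hε := by
    obtain ⟨z, c, hz, h1, h2⟩ := hx ε hε
    refine ⟨_, _, hz.star, ?_, by rwa [← star_sub, norm_star]⟩
    filter_upwards [h1] with j h1
    rwa [← star_sub, norm_star]
  smul r {x a} hx ε hε := by
    obtain ⟨z, c, hz, h1, h2⟩ := hx (ε / (‖r‖ + 1)) (by positivity)
    have key : ‖r‖ * (ε / (‖r‖ + 1)) ≤ ε := by
      rw [mul_div_assoc', div_le_iff₀ (by positivity)]
      nlinarith [norm_nonneg r]
    refine ⟨_, _, hz.smul r, ?_, ?_⟩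
    · filter_upwards [h1] with j h1
      rw [← smul_sub, norm_smul]
      exact (mul_le_mul_of_nonneg_left h1 (norm_nonneg r)).trans key
    · rw [← smul_sub, norm_smul]
      exact (mul_le_mul_of_nonneg_left h2 (norm_nonneg r)).trans key
  exists_rep := limRel.exists_rep hlim
  bounded {x a} hx := ⟨_, limRel.bounded hlim hx one_pos⟩
  tendsto_zero {x} hx := by
    refine Metric.tendsto_nhds.2 fun ε hε => ?_
    filter_upwards [limRel.bounded hlim hx (half_pos hε)] with j hj
    rw [norm_zero, zero_add] at hj
    simpa using hj.trans_lt (half_lt_self hε)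
  eq_zero {a} h := by
    refine norm_le_zero_iff.1 (le_of_forall_pos_le_add fun ε hε => ?_)
    obtain ⟨z, c, hz, h1, h2⟩ := h (ε / 2) (by positivity)
    have h3 : ‖c‖ ≤ ε / 2 := le_of_tendsto (hz.tendsto_norm hlim) (by simpa using h1)
    linarith [norm_le_norm_add_norm_sub' a c]
  of_approx := limRel.of_approx

lemma limRel.tendsto_apply {x : ∀ j, A j} {a : L} (hx : limRel φ ψ x a) :
    Tendsto (fun j => ‖ψ j (x j) - a‖) atTop (𝓝 0) := by
  refine Metric.tendsto_nhds.2 fun ε hε => ?_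
  obtain ⟨z, c, ⟨i, hi⟩, h1, h2⟩ := hx (ε / 3) (by positivity)
  filter_upwards [h1, eventually_ge_atTop i] with j h1 hj
  have h3 : ‖ψ j (x j) - c‖ ≤ ε / 3 := by
    rw [← (hi j hj).2, ← map_sub]
    exact (NonUnitalStarAlgHom.norm_apply_le (ψ j) _).trans h1
  have h4 := norm_sub_le_norm_sub_add_norm_sub (ψ j (x j)) c a
  rw [norm_sub_rev c a] at h4
  simp only [dist_zero_right, norm_norm]
  linarith

end Limit

/-! ### Stable finiteness of the limit -/

/-- Where every isometry is a unitary, polar decomposition shows that an approximate isometry is an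
equally good approximate unitary. -/
lemma norm_mul_star_sub_one_le {E : Type*} [CStarAlgebra E] [PartialOrder E] [StarOrderedRing E]
    (hE : ∀ u : E, star u * u = 1 → u * star u = 1) {x : E} (hx : ‖star x * x - 1‖ < 1) :
    ‖x * star x - 1‖ ≤ ‖star x * x - 1‖ := by
  set h := star x * x
  have hu : IsUnit h := by
    have := isUnit_one_sub_of_norm_lt_one (x := 1 - h) (by rwa [norm_sub_rev])
    rwa [sub_sub_cancel] at this
  have hh : IsStrictlyPositive h := IsStrictlyPositive.iff_of_unital.2 ⟨star_mul_self_nonneg x, hu⟩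
  set k := h ^ (-(1 / 2) : ℝ)
  have hk : star k = k := (CFC.rpow_nonneg (a := h)).isSelfAdjoint.star_eq
  have hkhk : k * h * k = 1 := CFC.conjugate_rpow_neg_one_half h hh
  set u := x * k
  have hu1 : star u * u = 1 := by
    simp only [u]
    rw [star_mul, hk, ← hkhk]
    simp only [h, mul_assoc]
  have hu2 := hE u hu1
  have hxx : u * h * star u = x * star x := by
    calc u * h * star u = x * (k * h * k) * star x := by
          simp only [u]; rw [star_mul, hk]; simp only [mul_assoc]
      _ = x * star x := by rw [hkhk, mul_one]
  have e : x * star x - 1 = u * (h - 1) * star u := by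
    rw [mul_sub, sub_mul, mul_one, hu2, hxx]
  have hun : ‖u‖ ≤ 1 := by
    have h1 := CStarRing.norm_star_mul_self (x := u)
    rw [hu1] at h1
    nlinarith [norm_nonneg u, IsQuasitrace.norm_one_le (B := E)]
  rw [e]
  calc ‖u * (h - 1) * star u‖ ≤ ‖u‖ * ‖h - 1‖ * ‖star u‖ := norm_mul₃_le
    _ ≤ 1 * ‖h - 1‖ * 1 := by
        rw [norm_star]
        gcongr
    _ = ‖h - 1‖ := by ring

namespace IsAsympRep

variable {B : ℕ → Type*} [∀ j, CStarAlgebra (B j)] [∀ j, PartialOrder (B j)]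
  [∀ j, StarOrderedRing (B j)] {D : Type*} [CStarAlgebra D]
  {R : (∀ j, B j) → D → Prop}

lemma mul_star_eq_one (hR : IsAsympRep R)
    (hB : ∀ j (u : B j), Star.star u * u = 1 → u * Star.star u = 1)
    {v : D} (hv : Star.star v * v = 1) : v * Star.star v = 1 := by
  obtain ⟨x, hx⟩ := hR.exists_rep v
  have h1 := hR.mul (hR.star hx) hx
  rw [hv] at h1
  have h2 := hR.tendsto_sub h1 hR.one
  have h3 : Tendsto (fun j => ‖x j * Star.star (x j) - 1‖) atTop (𝓝 0) := by
    refine squeeze_zero' (Eventually.of_forall fun _ => norm_nonneg _) ?_ h2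
    filter_upwards [h2.eventually_lt_const one_pos] with j hj
    exact norm_mul_star_sub_one_le (hB j) hj
  exact hR.unique (hR.congr' (hR.mul hx (hR.star hx)) h3) hR.one

end IsAsympRep

lemma IsInductiveLimit.isStablyFinite {A : ℕ → Type*}
    [∀ i, CStarAlgebra (A i)] [∀ i, PartialOrder (A i)] [∀ i, StarOrderedRing (A i)]
    {L : Type*} [CStarAlgebra L] [PartialOrder L] [StarOrderedRing L]
    {φ : ∀ i, A i →⋆ₐ[ℂ] A (i + 1)} {ψ : ∀ i, A i →⋆ₐ[ℂ] L}
    (hlim : IsInductiveLimit φ ψ) (hfin : ∀ i, IsStablyFinite (A i)) : IsStablyFinite L :=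
  fun n _ hv => (hlim.isAsympRep.matRel n).mul_star_eq_one (fun j u hu => hfin j n u hu) hv

/-! ### Ultralimits of quasitraces -/

namespace IsAsympRep

variable {B : ℕ → Type*} [∀ j, CStarAlgebra (B j)] [∀ j, PartialOrder (B j)]
  [∀ j, StarOrderedRing (B j)] {D : Type*} [CStarAlgebra D]
  {R : (∀ j, B j) → D → Prop} {σ : ℕ → ℕ} {t : ∀ m, B (σ m) → ℝ} {C : ℝ}

/-- `s` is the limit of the functions `t m` along a fixed nonprincipal ultrafilter: its values on
self-adjoint elements are the limits of the values of `t m` on self-adjoint representatives. -/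
def IsUltralimit (R : (∀ j, B j) → D → Prop) (σ : ℕ → ℕ) (t : ∀ m, B (σ m) → ℝ) (s : D → ℝ) : Prop :=
  ∀ (x : ∀ j, B j) (a : D), R x a → (∀ j, IsSelfAdjoint (x j)) → IsSelfAdjoint a →
    Tendsto (fun m => t m (x (σ m))) (hyperfilter ℕ : Filter ℕ) (𝓝 (s a))

lemma exists_isUltralimit (hR : IsAsympRep R) (hσ : Tendsto σ atTop atTop)
    (ht : ∀ m, OrderedQuasitrace (t m)) (hC : ∀ m, t m 1 ≤ C) :
    ∃ s, IsUltralimit R σ t s := by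
  have hω : (hyperfilter ℕ : Filter ℕ) ≤ atTop := Nat.hyperfilter_le_atTop
  have h1 : ∀ (x : ∀ j, B j) (a : D), R x a → (∀ j, IsSelfAdjoint (x j)) →
      ∃ c, Tendsto (fun m => t m (x (σ m))) (hyperfilter ℕ : Filter ℕ) (𝓝 c) := by
    intro x a hx hxs
    obtain ⟨M, hM⟩ := hR.bounded hx
    have h2 : ∀ᶠ m in (hyperfilter ℕ : Filter ℕ),
        t m (x (σ m)) ∈ Set.Icc (-(|M| * C)) (|M| * C) := by
      filter_upwards [hω (hσ.eventually hM)] with m hm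
      have h3 := (ht m).abs_sub_le (hxs (σ m)) (.zero _)
      rw [(ht m).zero, sub_zero, sub_zero] at h3
      refine abs_le.1 (h3.trans ?_)
      exact mul_le_mul (hm.trans (le_abs_self M)) (hC m) (ht m).one_nonneg (abs_nonneg M)
    obtain ⟨c, -, hc⟩ := isCompact_Icc.ultrafilter_le_nhds'
      ((hyperfilter ℕ).map fun m => t m (x (σ m))) h2
    exact ⟨c, hc⟩
  have h2 : ∀ a : D, ∃ c : ℝ, IsSelfAdjoint a → ∀ x, R x a → (∀ j, IsSelfAdjoint (x j)) →
      Tendsto (fun m => t m (x (σ m))) (hyperfilter ℕ : Filter ℕ) (𝓝 c) := by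
    intro a
    by_cases ha : IsSelfAdjoint a
    · obtain ⟨x, hx, hxs⟩ := hR.exists_isSelfAdjoint_rep ha
      obtain ⟨c, hc⟩ := h1 x a hx hxs
      refine ⟨c, fun _ y hy hys => ?_⟩
      have h3 := (hR.tendsto_sub hy hx).comp hσ
      have h4 : Tendsto (fun m => t m (y (σ m)) - t m (x (σ m))) (hyperfilter ℕ : Filter ℕ)
          (𝓝 0) := by
        refine squeeze_zero_norm (fun m => ?_) ((h3.mul_const C).mono_left hω |>.trans (by simp))
        rw [Real.norm_eq_abs]
        refine ((ht m).abs_sub_le (hys _) (hxs _)).trans ?_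
        exact mul_le_mul_of_nonneg_left (hC m) (norm_nonneg _)
      simpa using h4.add hc
    · exact ⟨0, fun h => absurd h ha⟩
  choose s hs using h2
  exact ⟨s, fun x a hx hxs ha => hs a ha x hx hxs⟩

variable [PartialOrder D] [StarOrderedRing D]

lemma exists_nonneg_rep (hR : IsAsympRep R) {a : D} (ha : 0 ≤ a) : ∃ x, R x a ∧ ∀ j, 0 ≤ x j := by
  obtain ⟨c, rfl⟩ := CStarAlgebra.nonneg_iff_eq_star_mul_self.1 ha
  obtain ⟨x, hx⟩ := hR.exists_rep c
  exact ⟨_, hR.mul (hR.star hx) hx, fun j => star_mul_self_nonneg _⟩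

lemma IsUltralimit.orderedQuasitrace (hR : IsAsympRep R) {s : D → ℝ} (hs : IsUltralimit R σ t s)
    (ht : ∀ m, OrderedQuasitrace (t m)) : OrderedQuasitrace s where
  mono a b ha hb hab := by
    obtain ⟨x, hx, hxs⟩ := hR.exists_isSelfAdjoint_rep ha
    obtain ⟨y, hy, hy0⟩ := hR.exists_nonneg_rep (sub_nonneg.2 hab)
    have h1 := hR.add hx hy
    rw [add_sub_cancel] at h1
    have h2 : ∀ j, IsSelfAdjoint (x j + y j) := fun j => (hxs j).add (hy0 j).isSelfAdjoint
    exact le_of_tendsto_of_tendsto' (hs _ _ hx hxs ha) (hs _ _ h1 h2 hb) fun m =>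
      (ht m).mono _ _ (hxs _) (h2 _) (le_add_of_nonneg_right (hy0 _))
  tracial a := by
    obtain ⟨x, hx⟩ := hR.exists_rep a
    have h1 := hs _ _ (hR.mul (hR.star hx) hx) (fun j => .star_mul_self _) (.star_mul_self _)
    have h2 := hs _ _ (hR.mul hx (hR.star hx)) (fun j => .mul_star_self _) (.mul_star_self _)
    simp only [(ht _).tracial] at h1
    exact tendsto_nhds_unique h1 h2
  smul c a ha := by
    obtain ⟨x, hx, hxs⟩ := hR.exists_isSelfAdjoint_rep ha
    have h1 := hs _ _ (hR.real_smul c hx) (fun j => .smul (.all _) (hxs j)) (.smul (.all _) ha)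
    simp only [(ht _).smul c _ (hxs _)] at h1
    exact tendsto_nhds_unique h1 ((hs _ _ hx hxs ha).const_mul c)
  add_smul_one a c ha := by
    obtain ⟨x, hx, hxs⟩ := hR.exists_isSelfAdjoint_rep ha
    have h1 := hs _ _ (hR.add hx (hR.real_smul c hR.one))
      (fun j => (hxs j).add (.smul (.all _) (.one _))) (ha.add (.smul (.all _) (.one _)))
    simp only [(ht _).add_smul_one _ c (hxs _)] at h1
    exact tendsto_nhds_unique h1 ((hs _ _ hx hxs ha).add
      ((hs _ _ hR.one (fun _ => .one _) (.one _)).const_mul c))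
  map_cfc_add h f g hh hf hg := by
    obtain ⟨x, hx, hxs⟩ := hR.exists_isSelfAdjoint_rep hh
    have hf' := hR.cfc hx hxs hh hf
    have hg' := hR.cfc hx hxs hh hg
    have h1 := hs _ _ (hR.add hf' hg') (fun j => IsSelfAdjoint.cfc.add IsSelfAdjoint.cfc)
      (IsSelfAdjoint.cfc.add IsSelfAdjoint.cfc)
    simp only [(ht _).map_cfc_add _ f g (hxs _) hf hg] at h1
    exact tendsto_nhds_unique h1 ((hs _ _ hf' (fun j => cfc_predicate _ _) (cfc_predicate _ _)).add
      (hs _ _ hg' (fun j => cfc_predicate _ _) (cfc_predicate _ _)))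
  add_le a b r ha hb hr := by
    obtain ⟨x, hx, hx0⟩ := hR.exists_nonneg_rep ha
    obtain ⟨y, hy, hy0⟩ := hR.exists_nonneg_rep hb
    have h1 := hs _ _ (hR.add hx hy) (fun j => (add_nonneg (hx0 j) (hy0 j)).isSelfAdjoint)
      (add_nonneg ha hb).isSelfAdjoint
    have h2 := (hs _ _ hx (fun j => (hx0 j).isSelfAdjoint) ha.isSelfAdjoint).const_mul (1 + r)
    have h3 := (hs _ _ hy (fun j => (hy0 j).isSelfAdjoint) hb.isSelfAdjoint).const_mul (1 + r⁻¹)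
    exact le_of_tendsto_of_tendsto' h1 (h2.add h3) fun m => (ht m).add_le _ _ r (hx0 _) (hy0 _) hr

end IsAsympRep

open ComplexStarModule in
lemma complexify_comp {B D : Type*} [CStarAlgebra B] [CStarAlgebra D] [PartialOrder B]
    [StarOrderedRing B] [PartialOrder D] [StarOrderedRing D] {s : B → ℝ} {t : D → ℝ}
    (θ : B →⋆ₙₐ[ℂ] D) (h : ∀ a, IsSelfAdjoint a → t (θ a) = s a) (x : B) :
    OrderedQuasitrace.complexify t (θ x) = OrderedQuasitrace.complexify s x := by
  have h1 : (ℜ (θ x) : D) = θ (ℜ x : B) := by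
    have e : ∀ {E : Type _} [CStarAlgebra E] (z : E), (ℜ z : E) = (2⁻¹ : ℂ) • (z + star z) := by
      intro E _ z
      rw [realPart_apply_coe, ← Complex.coe_smul]; simp
    rw [e]
    rw [realPart_apply_coe, ← Complex.coe_smul]
    simp [map_star]
  have h2 : (ℑ (θ x) : D) = θ (ℑ x : B) := by
    rw [imaginaryPart_apply_coe, imaginaryPart_apply_coe, ← Complex.coe_smul, ← Complex.coe_smul]
    simp [map_star, map_sub]
  rw [OrderedQuasitrace.complexify, OrderedQuasitrace.complexify, h1, h2, h _ (ℜ x).2, h _ (ℑ x).2]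

section MatrixUltralimit

variable {A : ℕ → Type*} [∀ i, CStarAlgebra (A i)] [∀ i, PartialOrder (A i)]
  [∀ i, StarOrderedRing (A i)] {L : Type*} [CStarAlgebra L] [PartialOrder L] [StarOrderedRing L]
  {R : (∀ j, A j) → L → Prop} {σ : ℕ → ℕ}

/-- Normalised 2-quasitraces on the `A (σ m)` have an ultralimit, which is a normalised 2-quasitrace
on `L`. -/
lemma exists_ultralimit_isMatrixExtension (hR : IsAsympRep R) (hσ : Tendsto σ atTop atTop)
    {τ : ∀ m, A (σ m) → ℂ} {T : ∀ m n, Mat n (A (σ m)) → ℂ}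
    (hT : ∀ m, IsMatrixExtension (τ m) (T m)) (hτ : ∀ m, τ m 1 = 1) :
    ∃ τ' ∈ QT L, ∃ T' : ∀ n, Mat n L → ℂ, IsMatrixExtension τ' T' ∧
      ∀ n, IsAsympRep.IsUltralimit (matRel R n) σ (fun m x => (T m n x).re)
        (fun x => (T' n x).re) := by
  choose s hs using fun n => (hR.matRel n).exists_isUltralimit hσ
    (fun m => (hT m).orderedQuasitrace n) (fun m => (hT m).one_re_le (hτ m) n)
  have hq : ∀ n, OrderedQuasitrace (s n) := fun n =>
    (hs n).orderedQuasitrace (hR.matRel n) fun m => (hT m).orderedQuasitrace n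
  have hpad : ∀ n m, n ≤ m → ∀ a : Mat n L, IsSelfAdjoint a → s m (pad m a) = s n a := by
    intro n m hnm a ha
    obtain ⟨x, hx, hxs⟩ := (hR.matRel n).exists_isSelfAdjoint_rep ha
    have h1 := hs m _ _ (hx.pad hR m) (fun j => (hxs j).map (padHom (A j) hnm))
      (ha.map (padHom L hnm))
    simp only [(hT _).map_pad n m hnm] at h1
    exact tendsto_nhds_unique h1 (hs n _ _ hx hxs ha)
  set T' : ∀ n, Mat n L → ℂ := fun n => OrderedQuasitrace.complexify (s n)
  have hpad' : ∀ n m, n ≤ m → ∀ a : Mat n L, T' m (pad m a) = T' n a := fun n m hnm a =>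
    complexify_comp (padHom L hnm) (hpad n m hnm) a
  have hre : ∀ n (a : Mat n L), IsSelfAdjoint a → (T' n a).re = s n a := fun n a ha => by
    simp only [T']
    rw [(hq n).complexify_of_isSelfAdjoint ha, Complex.ofReal_re]
  have hone : T' 1 1 = 1 := by
    have h1 := hs 1 _ _ (hR.matRel 1).one (fun _ => .one _) (.one _)
    have h2 : ∀ m, (T m 1 1).re = 1 := fun m => by
      rw [← single_one, (hT m).map_single, hτ, Complex.one_re]
    simp only [h2] at h1
    simp only [T']
    rw [(hq 1).complexify_of_isSelfAdjoint (.one _), ← tendsto_nhds_unique tendsto_const_nhds h1,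
      Complex.ofReal_one]
  refine ⟨fun x => T' 1 (single x), ⟨(hq 1).isQuasitrace.comp (singleHom L), ?_, T' 2,
    (hq 2).isQuasitrace, fun x => hpad' 1 2 one_le_two _⟩, T', ⟨fun n => (hq n).isQuasitrace,
    fun x => rfl, hpad'⟩, fun n x a hx hxs ha => ?_⟩
  · simp only [single_one, hone]
  · dsimp only
    rw [hre n a ha]
    exact hs n x a hx hxs ha

end MatrixUltralimit

/-! ### Dimension functions -/

section Dimension

variable {B : Type*} [CStarAlgebra B] [PartialOrder B] [StarOrderedRing B] {T : B → ℂ}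

lemma posRoot_cfc {a : B} (ha : IsSelfAdjoint a) {f : ℝ → ℝ} (hf : Continuous f)
    (hf0 : ∀ x, 0 ≤ f x) (k : ℕ) :
    posRoot (cfc f a) k = cfc (fun x => f x ^ (1 / (k : ℝ))) a := by
  rw [posRoot, CFC.rpow_eq_cfc_real (cfc_nonneg fun x _ => hf0 x)]
  exact (cfc_comp' (fun x => x ^ (1 / (k : ℝ))) f a
    (hg := (Real.continuous_rpow_const (by positivity)).continuousOn)).symm

lemma posRoot_eq_cfc {a : B} (ha : 0 ≤ a) (k : ℕ) :
    posRoot a k = cfc (fun x : ℝ => x ^ (1 / (k : ℝ))) a :=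
  CFC.rpow_eq_cfc_real ha

lemma continuous_rpow_inv (k : ℕ) : Continuous fun x : ℝ => x ^ (1 / (k : ℝ)) :=
  Real.continuous_rpow_const (by positivity)

lemma tendsto_rpow_inv {M : ℝ} (hM : 0 < M) :
    Tendsto (fun k : ℕ => M ^ (1 / (k : ℝ))) atTop (𝓝 1) := by
  have h := (Real.continuousAt_const_rpow hM.ne' (b := 0)).tendsto.comp
    (tendsto_one_div_atTop_nhds_zero_nat (𝕜 := ℝ))
  rwa [Real.rpow_zero] at h

namespace IsQuasitrace

/-- After normalising `a` to norm at most `1`, the sequence `T (a^{1/k})` is increasing. -/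
lemma exists_dimension (h : IsQuasitrace T) {a : B} (ha : 0 ≤ a) :
    ∃ d : ℝ, Tendsto (fun k : ℕ => T (posRoot a k)) atTop (𝓝 (d : ℂ)) := by
  set M := ‖a‖ + 1
  have hM : 0 < M := by positivity
  set u : ℕ → ℝ := fun k => (T (cfc (fun x : ℝ => (x / M) ^ (1 / ((k + 1 : ℕ) : ℝ))) a)).re
  have hcont : ∀ k : ℕ, Continuous fun x : ℝ => (x / M) ^ (1 / ((k + 1 : ℕ) : ℝ)) := fun k =>
    (continuous_rpow_inv _).comp (continuous_id.div_const M)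
  have hx : ∀ x ∈ spectrum ℝ a, 0 ≤ x / M ∧ x / M ≤ 1 := fun x hx => by
    obtain ⟨h0, h1⟩ := mem_Icc_of_mem_spectrum ha hx
    refine ⟨by positivity, ?_⟩
    rw [div_le_one hM]
    simp only [M]; linarith
  have hmono : Monotone u := by
    refine monotone_nat_of_le_succ fun k => ?_
    refine h.re_mono (cfc_predicate _ _) (cfc_predicate _ _)
      (cfc_mono (fun x hxs => ?_) (hcont k).continuousOn (hcont (k + 1)).continuousOn)
    obtain ⟨h0, h1⟩ := hx x hxs
    rcases h0.eq_or_lt with h2 | h2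
    · rw [← h2, Real.zero_rpow (by positivity), Real.zero_rpow (by positivity)]
    · refine Real.rpow_le_rpow_of_exponent_ge h2 h1 ?_
      gcongr
      lia
  have hbdd : BddAbove (Set.range u) := by
    refine ⟨(T 1).re, ?_⟩
    rintro _ ⟨k, rfl⟩
    refine h.re_mono (cfc_predicate _ _) (.one B) (cfc_le_one _ _ fun x hxs => ?_)
    exact Real.rpow_le_one (hx x hxs).1 (hx x hxs).2 (by positivity)
  have hlim := tendsto_atTop_ciSup hmono hbdd
  refine ⟨⨆ k, u k, (tendsto_add_atTop_iff_nat 1).1 ?_⟩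
  have h1 : ∀ k : ℕ, T (posRoot a (k + 1))
      = ((M ^ (1 / ((k + 1 : ℕ) : ℝ)) * u k : ℝ) : ℂ) := by
    intro k
    have h2 : posRoot a (k + 1) = M ^ (1 / ((k + 1 : ℕ) : ℝ)) •
        cfc (fun x : ℝ => (x / M) ^ (1 / ((k + 1 : ℕ) : ℝ))) a := by
      rw [posRoot_eq_cfc ha, ← cfc_smul (hf := (hcont k).continuousOn)]
      refine cfc_congr fun x hxs => ?_
      simp only [smul_eq_mul]
      rw [← Real.mul_rpow hM.le (hx x hxs).1, mul_div_cancel₀ _ hM.ne']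
    rw [h2, h.smul_of_isSelfAdjoint (cfc_predicate _ _), Complex.ofReal_mul]
    congr 1
    apply Complex.ext
    · simp [u]
    · rw [Complex.ofReal_im]
      exact h.im_eq_zero (cfc_predicate _ _)
  simp only [h1]
  refine (Complex.continuous_ofReal.tendsto _).comp ?_
  have h3 := ((tendsto_rpow_inv hM).comp (tendsto_add_atTop_nat 1)).mul hlim
  simpa using h3

lemma tendsto_re {a : B} {d : ℝ} (hd : Tendsto (fun k : ℕ => T (posRoot a k)) atTop (𝓝 (d : ℂ))) :
    Tendsto (fun k : ℕ => (T (posRoot a k)).re) atTop (𝓝 d) :=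
  (Complex.continuous_re.tendsto _).comp hd

/-- `f(a)` has trace at most the rank of `g(a)` if `0 ≤ f ≤ 1` vanishes where `g` does, quantitatively
`f ≤ ramp (g / c)`. -/
lemma re_le_dimension (h : IsQuasitrace T) {a : B} (ha : IsSelfAdjoint a) {f g : ℝ → ℝ}
    (hf : Continuous f) (hg : Continuous g) (hg0 : ∀ x, 0 ≤ g x) {c : ℝ} (hc : 0 < c)
    (hfg : ∀ x, f x ≤ ramp (g x / c)) {d : ℝ}
    (hd : Tendsto (fun k : ℕ => T (posRoot (cfc g a) k)) atTop (𝓝 (d : ℂ))) :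
    (T (cfc f a)).re ≤ d := by
  have h1 : Tendsto (fun k : ℕ => c⁻¹ ^ (1 / (k : ℝ)) * (T (posRoot (cfc g a) k)).re) atTop
      (𝓝 (1 * d)) := (tendsto_rpow_inv (inv_pos.2 hc)).mul (tendsto_re hd)
  rw [one_mul] at h1
  refine ge_of_tendsto h1 ?_
  filter_upwards [eventually_ge_atTop 1] with k hk
  have hcont : Continuous fun x => g x ^ (1 / (k : ℝ)) := (continuous_rpow_inv k).comp hg
  rw [posRoot_cfc ha hg hg0, ← h.re_smul (cfc_predicate _ _),
    ← cfc_const_mul _ _ _ (hf := hcont.continuousOn)]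
  refine h.re_mono (cfc_predicate _ _) (cfc_predicate _ _)
    (cfc_mono (fun x _ => ?_) hf.continuousOn (hcont.const_mul _).continuousOn)
  rw [← Real.mul_rpow (by positivity) (hg0 x), inv_mul_eq_div]
  refine (hfg x).trans ?_
  have h0 : 0 ≤ g x / c := div_nonneg (hg0 x) hc.le
  have hk1 : 1 / (k : ℝ) ≤ 1 := by
    rw [div_le_one (by positivity)]
    exact_mod_cast hk
  rcases le_total (g x / c) 1 with h2 | h2
  · rw [ramp_of_mem h0 h2]
    rcases h0.eq_or_lt with h3 | h3
    · rw [← h3]; positivity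
    · calc g x / c = (g x / c) ^ (1 : ℝ) := (Real.rpow_one _).symm
        _ ≤ (g x / c) ^ (1 / (k : ℝ)) := Real.rpow_le_rpow_of_exponent_ge h3 h2 hk1
  · exact (ramp_le_one _).trans (Real.one_le_rpow h2 (by positivity))

/-- The rank of `g(a)` is at most the trace of any `f(a) ≥ 0` with `f ≥ 1` where `g > 0`. -/
lemma dimension_le_re (h : IsQuasitrace T) {a : B} (ha : 0 ≤ a) {f g : ℝ → ℝ}
    (hf : Continuous f) (hg : Continuous g) (hg0 : ∀ x, 0 ≤ g x) (hgm : Monotone g)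
    (hf0 : ∀ x, 0 ≤ f x) (hfg : ∀ x, 0 < g x → 1 ≤ f x) {d : ℝ}
    (hd : Tendsto (fun k : ℕ => T (posRoot (cfc g a) k)) atTop (𝓝 (d : ℂ))) :
    d ≤ (T (cfc f a)).re := by
  set M := g ‖a‖ + 1
  have hM : 0 < M := by have := hg0 ‖a‖; positivity
  have h1 : Tendsto (fun k : ℕ => M ^ (1 / (k : ℝ)) * (T (cfc f a)).re) atTop
      (𝓝 (1 * (T (cfc f a)).re)) := (tendsto_rpow_inv hM).mul tendsto_const_nhds
  rw [one_mul] at h1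
  refine le_of_tendsto_of_tendsto (tendsto_re hd) h1 ?_
  filter_upwards [eventually_ge_atTop 1] with k hk
  have hcont : Continuous fun x => g x ^ (1 / (k : ℝ)) := (continuous_rpow_inv k).comp hg
  have hk0 : 0 < 1 / (k : ℝ) := by positivity
  rw [posRoot_cfc ha.isSelfAdjoint hg hg0, ← h.re_smul (cfc_predicate _ _),
    ← cfc_const_mul _ _ _ (hf := hf.continuousOn)]
  refine h.re_mono (cfc_predicate _ _) (cfc_predicate _ _)
    (cfc_mono (fun x hx => ?_) hcont.continuousOn (hf.const_mul _).continuousOn)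
  rcases (hg0 x).eq_or_lt with h2 | h2
  · rw [← h2, Real.zero_rpow hk0.ne']
    exact mul_nonneg (by positivity) (hf0 x)
  · have h3 : g x ≤ M := (hgm (mem_Icc_of_mem_spectrum ha hx).2).trans (by simp [M])
    calc g x ^ (1 / (k : ℝ)) ≤ M ^ (1 / (k : ℝ)) := Real.rpow_le_rpow h2.le h3 hk0.le
      _ ≤ M ^ (1 / (k : ℝ)) * f x := le_mul_of_one_le_right (by positivity) (hfg x h2)

/-- Lower semicontinuity: the rank of `a` is determined by the functions of `a` that vanish near
`0`. -/
lemma dimension_le_of_forall (h : IsQuasitrace T) {a : B} (ha : 0 ≤ a) {S d : ℝ}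
    (hS : ∀ δ > 0, (T (cfc (fun x => ramp ((x - δ) / δ)) a)).re ≤ S)
    (hd : Tendsto (fun k : ℕ => T (posRoot a k)) atTop (𝓝 (d : ℂ))) : d ≤ S := by
  set M := ‖a‖ + 1
  have hM : 0 < M := by positivity
  have h1 : Tendsto (fun k : ℕ => M ^ (1 / (k : ℝ)) * S) atTop (𝓝 (1 * S)) :=
    (tendsto_rpow_inv hM).mul tendsto_const_nhds
  rw [one_mul] at h1
  refine le_of_tendsto_of_tendsto (tendsto_re hd) h1 ?_
  filter_upwards [eventually_ge_atTop 1] with k hk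
  have hk0 : 0 < 1 / (k : ℝ) := by positivity
  have h2 : ∀ δ : ℝ, 0 < δ → (T (posRoot a k)).re ≤
      M ^ (1 / (k : ℝ)) * S + (2 * δ) ^ (1 / (k : ℝ)) * (T 1).re := by
    intro δ hδ
    have hcont : Continuous fun x : ℝ => ramp ((x - δ) / δ) := by fun_prop
    have h3 : (T (posRoot a k)).re ≤
        (T (M ^ (1 / (k : ℝ)) • cfc (fun x => ramp ((x - δ) / δ)) a
          + (2 * δ) ^ (1 / (k : ℝ)) • (1 : B))).re := by
      have h4 : M ^ (1 / (k : ℝ)) • cfc (fun x => ramp ((x - δ) / δ)) a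
          + (2 * δ) ^ (1 / (k : ℝ)) • (1 : B) = cfc (fun x => M ^ (1 / (k : ℝ)) * ramp ((x - δ) / δ)
            + (2 * δ) ^ (1 / (k : ℝ))) a := by
        rw [cfc_add_const _ _ a (hf := (hcont.const_mul _).continuousOn),
          cfc_const_mul _ _ a (hf := hcont.continuousOn), Algebra.algebraMap_eq_smul_one]
      rw [h4, posRoot_eq_cfc ha]
      refine h.re_mono (cfc_predicate _ _) (cfc_predicate _ _) (cfc_mono (fun x hx => ?_)
        (continuous_rpow_inv k).continuousOn
        ((hcont.const_mul _).add continuous_const).continuousOn)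
      obtain ⟨h5, h6⟩ := mem_Icc_of_mem_spectrum ha hx
      rcases le_total x (2 * δ) with h7 | h7
      · have h8 : x ^ (1 / (k : ℝ)) ≤ (2 * δ) ^ (1 / (k : ℝ)) := Real.rpow_le_rpow h5 h7 hk0.le
        have h9 : 0 ≤ M ^ (1 / (k : ℝ)) * ramp ((x - δ) / δ) :=
          mul_nonneg (by positivity) (ramp_nonneg _)
        linarith
      · have h8 : x ^ (1 / (k : ℝ)) ≤ M ^ (1 / (k : ℝ)) :=
          Real.rpow_le_rpow h5 (h6.trans (by simp [M])) hk0.le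
        rw [ramp_of_one_le (by rw [le_div_iff₀ hδ]; linarith), mul_one]
        have h9 : 0 ≤ (2 * δ) ^ (1 / (k : ℝ)) := by positivity
        linarith
    rw [h.re_add_smul_one (.smul (.all _) (cfc_predicate _ _)), h.re_smul (cfc_predicate _ _)] at h3
    refine h3.trans ?_
    gcongr
    exact hS δ hδ
  have h3 : Tendsto (fun δ : ℝ => M ^ (1 / (k : ℝ)) * S + (2 * δ) ^ (1 / (k : ℝ)) * (T 1).re)
      (𝓝[>] 0) (𝓝 (M ^ (1 / (k : ℝ)) * S)) := by
    have h4 : Continuous fun δ : ℝ =>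
        M ^ (1 / (k : ℝ)) * S + (2 * δ) ^ (1 / (k : ℝ)) * (T 1).re :=
      continuous_const.add (((continuous_rpow_inv k).comp (continuous_const_mul 2)).mul
        continuous_const)
    have h5 := (h4.tendsto 0).mono_left (nhdsWithin_le_nhds (s := Set.Ioi 0))
    simpa [Real.zero_rpow hk0.ne', -one_div] using h5
  exact ge_of_tendsto h3 (eventually_mem_nhdsWithin.mono fun δ hδ => h2 δ hδ)

end IsQuasitrace
end Dimension

/-! ### Rørdam's lemma and Cuntz subequivalence in the limit -/

/-- The continuous functional calculus for real functions in a C⋆-algebra, with its instance arguments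
in terms of the C⋆-algebra structure alone. -/
noncomputable abbrev realCfc {B : Type*} [CStarAlgebra B] (f : ℝ → ℝ) (a : B) : B := cfc f a

section Rordam

variable {B : Type*} [CStarAlgebra B] [PartialOrder B] [StarOrderedRing B]

/-- If `b` dominates a multiple of `1` on the range of `e`, then `e²` lies in the closure of the
elements `r b r⋆`: the elements `r = e (e b e + s)^{-1/2} e` for small `s > 0` achieve this. -/
lemma exists_norm_conj_sub_mul_self_le {e b : B} (he : IsSelfAdjoint e) (hb : 0 ≤ b) {κ η : ℝ}
    (hκ : 0 < κ) (hη : 0 < η) (h : κ • (e * e) ≤ e * b * e) :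
    ∃ r : B, ‖r * b * star r - e * e‖ ≤ η := by
  set y := e * b * e
  have hy : 0 ≤ y := by simpa [he.star_eq] using star_left_conjugate_nonneg hb e
  set s := η * κ
  have hs : 0 < s := by positivity
  set w := y + s • (1 : B)
  have hs1 : IsStrictlyPositive (s • (1 : B)) := IsStrictlyPositive.smul hs isStrictlyPositive_one
  have hw : IsStrictlyPositive w := hs1.nonneg_add hy
  set k := w ^ (-(1 / 2) : ℝ)
  have hk : star k = k := (CFC.rpow_nonneg (a := w)).isSelfAdjoint.star_eq
  have hkwk : k * w * k = 1 := CFC.conjugate_rpow_neg_one_half w hw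
  have hkyk : k * y * k = 1 - s • (k * k) := by
    rw [← hkwk]
    simp only [w]
    rw [mul_add, add_mul]
    simp
  refine ⟨e * k * e, ?_⟩
  have e1 : e * k * e * b * star (e * k * e) - e * e = -(s • (star (k * e) * (k * e))) := by
    calc e * k * e * b * star (e * k * e) - e * e = e * (k * y * k) * e - e * e := by
          simp only [y, star_mul, he.star_eq, hk, mul_assoc]
      _ = _ := by
          rw [hkyk, star_mul, hk, he.star_eq, mul_sub, sub_mul, mul_one]
          simp [mul_assoc]
  have h1 : κ • (k * (e * e) * k) ≤ 1 := by
    calc κ • (k * (e * e) * k) = k * (κ • (e * e)) * k := by simp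
      _ ≤ k * y * k := conj_le_conj_of_isSelfAdjoint hk h
      _ ≤ k * w * k := conj_le_conj_of_isSelfAdjoint hk (le_add_of_nonneg_right hs1.nonneg)
      _ = 1 := hkwk
  have h2 : k * (e * e) * k = (k * e) * star (k * e) := by
    rw [star_mul, hk, he.star_eq]; simp only [mul_assoc]
  have h3 : κ * ‖star (k * e) * (k * e)‖ ≤ 1 := by
    have h4 := CStarAlgebra.norm_le_norm_of_nonneg_of_le
      (smul_nonneg hκ.le (h2 ▸ mul_star_self_nonneg (k * e))) h1
    rw [norm_smul, h2, CStarRing.norm_self_mul_star, Real.norm_of_nonneg hκ.le] at h4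
    rw [CStarRing.norm_star_mul_self]
    exact h4.trans IsQuasitrace.norm_one_le
  rw [e1, norm_neg, norm_smul, Real.norm_of_nonneg hs.le]
  calc s * ‖star (k * e) * (k * e)‖ = η * (κ * ‖star (k * e) * (k * e)‖) := mul_assoc _ _ _
    _ ≤ η * 1 := by gcongr
    _ = η := mul_one η

/-- `(a - ε)₊`. -/
noncomputable def cutdown {B : Type*} [CStarAlgebra B] (a : B) (ε : ℝ) : B :=
  cfc (fun x : ℝ => max (x - ε) 0) a

lemma map_cutdown {A B : Type*} [CStarAlgebra A] [CStarAlgebra B] (θ : A →⋆ₐ[ℂ] B) {a : A}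
    (ha : IsSelfAdjoint a) (ε : ℝ) : θ (cutdown a ε) = cutdown (θ a) ε :=
  StarAlgHomClass.map_cfc (S := ℂ) θ _ a (by fun_prop)
    (AddMonoidHomClass.continuous_of_bound θ 1 fun x => by
      simpa using NonUnitalStarAlgHom.norm_apply_le θ x) ha (ha.map θ)

/-- Rørdam's lemma: if `‖b - c‖ < δ`, then `(c - δ)₊` is Cuntz subequivalent to `b`. -/
lemma exists_norm_conj_sub_cutdown_le {b c : B} (hb : 0 ≤ b) (hc : 0 ≤ c) {δ' δ η : ℝ}
    (hbc : ‖b - c‖ ≤ δ') (hδ : δ' < δ) (hη : 0 < η) :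
    ∃ r : B, ‖r * b * star r - cutdown c δ‖ ≤ η := by
  set e := cfc (fun x : ℝ => √(max (x - δ) 0)) c
  have he : IsSelfAdjoint e := cfc_predicate _ _
  have hcf : Continuous fun x : ℝ => √(max (x - δ) 0) := by fun_prop
  have hee : e * e = cutdown c δ := by
    simp only [e, cutdown]
    rw [← cfc_mul _ _ c hcf.continuousOn hcf.continuousOn]
    exact cfc_congr fun x _ => Real.mul_self_sqrt (le_max_right _ _)
  have h1 : c - δ' • (1 : B) ≤ b := by
    have h2 : IsSelfAdjoint (c - b) := hc.isSelfAdjoint.sub hb.isSelfAdjoint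
    have h3 := h2.le_algebraMap_norm_self
    rw [Algebra.algebraMap_eq_smul_one, norm_sub_rev] at h3
    have h4 : ‖b - c‖ • (1 : B) ≤ δ' • (1 : B) := smul_le_smul_of_nonneg_right hbc zero_le_one
    have h5 := h3.trans h4
    rw [sub_le_iff_le_add] at h5 ⊢
    rwa [add_comm]
  have h2 : (δ - δ') • (e * e) ≤ e * b * e := by
    refine le_trans ?_ (conj_le_conj_of_isSelfAdjoint he h1)
    have h3 : c - δ' • (1 : B) = cfc (fun x : ℝ => x - δ') c := by
      rw [cfc_sub _ _ c, cfc_id' ℝ c, cfc_const _ c, Algebra.algebraMap_eq_smul_one]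
    rw [h3, hee, cutdown, ← cfc_const_mul _ _ c (hf := by fun_prop)]
    simp only [e]
    rw [← cfc_mul _ _ c hcf.continuousOn (by fun_prop), ← cfc_mul _ _ c (by fun_prop)
      hcf.continuousOn]
    refine cfc_mono (fun x _ => ?_) (by fun_prop) (by fun_prop)
    have h4 : √(max (x - δ) 0) * (x - δ') * √(max (x - δ) 0) = (x - δ') * max (x - δ) 0 := by
      rw [mul_right_comm, Real.mul_self_sqrt (le_max_right _ _), mul_comm]
    rw [h4]
    rcases le_total x δ with h5 | h5
    · rw [max_eq_right (by linarith)]; simp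
    · exact mul_le_mul_of_nonneg_right (by linarith) (le_max_right _ _)
  rw [← hee]
  exact exists_norm_conj_sub_mul_self_le he hb (sub_pos.2 hδ) hη h2

lemma cutdown_nonneg (a : B) (ε : ℝ) : 0 ≤ cutdown a ε :=
  cfc_nonneg fun _ _ => le_max_right _ _

/-- `(a - ε)₊` in `M_∞(B)₊`. -/
noncomputable def MInfPos.cutdown (a : MInfPos B) (ε : ℝ) : MInfPos B :=
  ⟨a.1, CuntzComparison.cutdown a.2.1 ε, cutdown_nonneg _ _⟩

lemma norm_cutdown_sub_le {a : B} (ha : 0 ≤ a) {ε : ℝ} (hε : 0 ≤ ε) :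
    ‖cutdown a ε - a‖ ≤ ε := by
  rw [cutdown]
  nth_rw 2 [← cfc_id' ℝ a]
  rw [← cfc_sub _ _ a]
  refine norm_cfc_le hε fun x hx => ?_
  have h0 := (IsQuasitrace.mem_Icc_of_mem_spectrum ha hx).1
  rw [Real.norm_eq_abs, abs_le]
  rcases le_total x ε with h | h
  · rw [max_eq_right (by linarith)]; constructor <;> linarith
  · rw [max_eq_left (by linarith)]; constructor <;> linarith

lemma CuntzLE.exists_norm_lt {a b : MInfPos B} (h : CuntzLE a b) {ε : ℝ} (hε : 0 < ε) :
    ∃ N, a.1 ≤ N ∧ b.1 ≤ N ∧ ∃ v : Mat N B, ‖v * pad N b.2.1 * star v - pad N a.2.1‖ < ε := by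
  obtain ⟨N, v, hN, hv⟩ := h
  obtain ⟨k, hk⟩ := (hv.eventually_lt_const hε).exists
  exact ⟨N k, (hN k).1, (hN k).2, v k, hk⟩

lemma cuntzLE_of_forall {a b : MInfPos B} (h : ∀ ε > 0, ∃ N, a.1 ≤ N ∧ b.1 ≤ N ∧
    ∃ v : Mat N B, ‖v * pad N b.2.1 * star v - pad N a.2.1‖ ≤ ε) : CuntzLE a b := by
  choose N h1 h2 v hv using fun k : ℕ => h (1 / ((k : ℝ) + 1)) (by positivity)
  exact ⟨N, v, fun k => ⟨h1 k, h2 k⟩,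
    squeeze_zero (fun _ => norm_nonneg _) hv tendsto_one_div_add_atTop_nhds_zero_nat⟩

end Rordam

section MatMap

variable {A L : Type*} [CStarAlgebra A] [CStarAlgebra L]

/-- The entrywise application `M_n(A) → M_n(L)` of a unital ⋆-homomorphism. -/
noncomputable def matMap (ψ : A →⋆ₐ[ℂ] L) (n : ℕ) : Mat n A →⋆ₐ[ℂ] Mat n L :=
  { CStarMatrix.mapₙₐ (n := Fin n) (ψ : A →⋆ₙₐ[ℂ] L) with
    map_one' := by
      ext i j
      change ψ ((1 : Mat n A) i j) = (1 : Mat n L) i j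
      by_cases h : i = j
      · subst h; simp
      · simp [CStarMatrix.one_apply_ne h]
    commutes' := fun c => by
      ext i j
      change ψ (algebraMap ℂ (Mat n A) c i j) = algebraMap ℂ (Mat n L) c i j
      simp only [Algebra.algebraMap_eq_smul_one, CStarMatrix.smul_apply, map_smul]
      by_cases h : i = j
      · subst h; simp
      · simp [CStarMatrix.one_apply_ne h] }

lemma matMap_apply (ψ : A →⋆ₐ[ℂ] L) (n : ℕ) (X : Mat n A) (i j : Fin n) :
    matMap ψ n X i j = ψ (X i j) := rfl

lemma matMap_pad (ψ : A →⋆ₐ[ℂ] L) {n : ℕ} (m : ℕ) (X : Mat n A) :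
    matMap ψ m (pad m X) = pad m (matMap ψ n X) := by
  ext i j
  rw [matMap_apply, pad_apply, pad_apply]
  split_ifs
  · rfl
  · exact map_zero ψ

end MatMap

lemma tendsto_norm_matMap_sub {A : ℕ → Type*} [∀ i, CStarAlgebra (A i)] {L : Type*}
    [CStarAlgebra L] [PartialOrder L] [StarOrderedRing L] {φ : ∀ i, A i →⋆ₐ[ℂ] A (i + 1)}
    {ψ : ∀ i, A i →⋆ₐ[ℂ] L} {n : ℕ} {X : ∀ j, Mat n (A j)} {a : Mat n L}
    (hX : matRel (limRel φ ψ) n X a) :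
    Tendsto (fun j => ‖matMap (ψ j) n (X j) - a‖) atTop (𝓝 0) :=
  tendsto_norm_of_entries _ fun p q => (hX p q).tendsto_apply

section Limit

variable {A : ℕ → Type*} [∀ i, CStarAlgebra (A i)] [∀ i, PartialOrder (A i)]
  [∀ i, StarOrderedRing (A i)] {L : Type*} [CStarAlgebra L] [PartialOrder L] [StarOrderedRing L]
  {φ : ∀ i, A i →⋆ₐ[ℂ] A (i + 1)} {ψ : ∀ i, A i →⋆ₐ[ℂ] L}

lemma norm_conj_mul_sub_le {E F D : Type*} [CStarAlgebra E] [CStarAlgebra F] [CStarAlgebra D]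
    (θ : E →⋆ₙₐ[ℂ] D) (θ' : F →⋆ₙₐ[ℂ] D) {V : D} {a x c : E} {b r y : F} {ε : ℝ} (hε : 0 ≤ ε)
    (h1 : ‖V * θ' y * star V - θ c‖ ≤ ε) (h2 : ‖r * b * star r - y‖ ≤ ε / (‖V‖ ^ 2 + 1))
    (h3 : ‖c - x‖ ≤ ε) (h4 : ‖x - a‖ ≤ ε) :
    ‖V * θ' r * θ' b * star (V * θ' r) - θ a‖ ≤ 4 * ε := by
  have e1 : V * θ' r * θ' b * star (V * θ' r) - θ a
      = V * θ' (r * b * star r - y) * star V + (V * θ' y * star V - θ c)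
        + θ (c - x) + θ (x - a) := by
    simp only [map_sub, map_mul, map_star, star_mul, mul_sub, sub_mul, mul_assoc]
    abel
  have hC : 0 < ‖V‖ ^ 2 + 1 := by positivity
  have h5 : ‖V * θ' (r * b * star r - y) * star V‖ ≤ ε := by
    calc _ ≤ ‖V‖ * ‖θ' (r * b * star r - y)‖ * ‖star V‖ := norm_mul₃_le
      _ ≤ ‖V‖ * (ε / (‖V‖ ^ 2 + 1)) * ‖V‖ := by
          rw [norm_star]
          gcongr
          exact (NonUnitalStarAlgHom.norm_apply_le θ' _).trans h2
      _ = ‖V‖ ^ 2 / (‖V‖ ^ 2 + 1) * ε := by ring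
      _ ≤ 1 * ε := by
          gcongr
          rw [div_le_one hC]
          linarith
      _ = ε := one_mul ε
  have h6 := (NonUnitalStarAlgHom.norm_apply_le θ _).trans h3
  have h7 := (NonUnitalStarAlgHom.norm_apply_le θ _).trans h4
  rw [e1]
  refine (norm_add₄_le).trans ?_
  linarith

/-- A Cuntz subequivalence between cut-downs of representatives far out in the sequence yields an
approximate one in the limit. The conjugating element at the finite stage has no norm bound, so
Rørdam's lemma is used in the limit to replace the cut-down representative of `b` by `b`
itself. -/
lemma eventually_exists_of_cuntzLE {a b : MInfPos L} {X : ∀ j, Mat a.1 (A j)}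
    {Y : ∀ j, Mat b.1 (A j)} (hX : matRel (limRel φ ψ) a.1 X a.2.1) (hX0 : ∀ j, 0 ≤ X j)
    (hY : matRel (limRel φ ψ) b.1 Y b.2.1) (hY0 : ∀ j, 0 ≤ Y j) {ε δ : ℝ} (hε : 0 < ε)
    (hδ : 0 < δ) :
    ∀ᶠ j in atTop, CuntzLE (MInfPos.cutdown ⟨a.1, X j, hX0 j⟩ ε)
        (MInfPos.cutdown ⟨b.1, Y j, hY0 j⟩ δ) →
      ∃ N, a.1 ≤ N ∧ b.1 ≤ N ∧
        ∃ W : Mat N L, ‖W * pad N b.2.1 * star W - pad N a.2.1‖ ≤ 4 * ε := by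
  filter_upwards [(tendsto_norm_matMap_sub hX).eventually_lt_const hε,
    (tendsto_norm_matMap_sub hY).eventually_lt_const (half_pos hδ)] with j h1 h2 h3
  obtain ⟨N, haN, hbN, V, hV⟩ := h3.exists_norm_lt hε
  dsimp only [MInfPos.cutdown] at haN hbN hV
  refine ⟨N, haN, hbN, ?_⟩
  set x := matMap (ψ j) a.1 (X j)
  set y := matMap (ψ j) b.1 (Y j)
  have hx0 : 0 ≤ x := map_nonneg (matMap (ψ j) a.1) (hX0 j)
  have hy0 : 0 ≤ y := map_nonneg (matMap (ψ j) b.1) (hY0 j)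
  set V' := matMap (ψ j) N V
  have hV' : ‖V' * pad N (cutdown y δ) * star V'
      - pad N (cutdown x ε)‖ ≤ ε := by
    have h4 := NonUnitalStarAlgHom.norm_apply_le (matMap (ψ j) N)
      (V * pad N (cutdown (Y j) δ) * star V
        - pad N (cutdown (X j) ε))
    rw [map_sub, map_mul, map_mul, map_star, matMap_pad, matMap_pad,
      map_cutdown _ (hX0 j).isSelfAdjoint, map_cutdown _ (hY0 j).isSelfAdjoint] at h4
    exact h4.trans hV.le
  obtain ⟨r, hr⟩ := exists_norm_conj_sub_cutdown_le b.2.2 hy0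
    (by rw [norm_sub_rev]; exact h2.le) (half_lt_self hδ) (η := ε / (‖V'‖ ^ 2 + 1)) (by positivity)
  exact ⟨V' * pad N r, norm_conj_mul_sub_le (padHom L haN) (padHom L hbN) hε.le hV' hr
    (norm_cutdown_sub_le hx0 hε.le) h1.le⟩

/-! ### Strict comparison of the limit -/

/-- A failure of comparison in `M_∞(L)` is reflected, with an error tending to `0`, by dimension
functions on the `A_j`: these exist by `r`-strict comparison, as the cut-downs of representatives
cannot be Cuntz comparable. -/
lemma exists_seq_dimension (hrc : liminf (fun i => rc (A i)) atTop = 0) {a b : MInfPos L}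
    {X : ∀ j, Mat a.1 (A j)} {Y : ∀ j, Mat b.1 (A j)} (hX : matRel (limRel φ ψ) a.1 X a.2.1)
    (hX0 : ∀ j, 0 ≤ X j) (hY : matRel (limRel φ ψ) b.1 Y b.2.1) (hY0 : ∀ j, 0 ≤ Y j) {ε : ℝ}
    (hε : 0 < ε) (hab : ¬ ∃ N, a.1 ≤ N ∧ b.1 ≤ N ∧
        ∃ W : Mat N L, ‖W * pad N b.2.1 * star W - pad N a.2.1‖ ≤ 4 * ε) :
    ∃ σ : ℕ → ℕ, StrictMono σ ∧ ∀ m : ℕ, ∃ d ∈ LDF (A (σ m)),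
      d (MInfPos.cutdown ⟨b.1, Y (σ m), hY0 _⟩ (1 / ((m : ℝ) + 1)))
        ≤ d (MInfPos.cutdown ⟨a.1, X (σ m), hX0 _⟩ ε) + 1 / ((m : ℝ) + 1) := by
  refine extraction_forall_of_frequently (P := fun m j => ∃ d ∈ LDF (A j),
    d (MInfPos.cutdown ⟨b.1, Y j, hY0 _⟩ (1 / ((m : ℝ) + 1)))
      ≤ d (MInfPos.cutdown ⟨a.1, X j, hX0 _⟩ ε) + 1 / ((m : ℝ) + 1)) fun m => ?_
  have hm : (0 : ℝ) < 1 / ((m : ℝ) + 1) := by positivity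
  have h1 : ∃ᶠ j in atTop, rc (A j) < ENNReal.ofReal (1 / ((m : ℝ) + 1)) :=
    frequently_lt_of_liminf_lt (by isBoundedDefault) (by rw [hrc]; exact ENNReal.ofReal_pos.2 hm)
  refine (h1.and_eventually (eventually_exists_of_cuntzLE hX hX0 hY hY0 hε hm)).mono ?_
  rintro j ⟨h2, h3⟩
  have h4 := fun h => hab (h3 h)
  simp only [rc, iInf_lt_iff] at h2
  obtain ⟨r, hr, h5⟩ := h2
  have h6 : (r : ℝ) < 1 / ((m : ℝ) + 1) := by
    rwa [← ENNReal.ofReal_coe_nnreal, ENNReal.ofReal_lt_ofReal_iff hm] at h5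
  have h7 : ¬ _ := fun h => h4 (hr _ _ h)
  push Not at h7
  obtain ⟨d, hd, h8⟩ := h7
  exact ⟨d, hd, by linarith⟩

lemma IsInductiveLimit.hasStrictComparison (hlim : IsInductiveLimit φ ψ)
    (hrc : liminf (fun i => rc (A i)) atTop = 0) : HasStrictComparison L := by
  intro a b hab
  by_contra hcon
  have h1 : ¬ _ := fun h => hcon (cuntzLE_of_forall h)
  push Not at h1
  obtain ⟨ε, hε, hε'⟩ := h1
  have hR := hlim.isAsympRep
  obtain ⟨X, hX, hX0⟩ := (hR.matRel a.1).exists_nonneg_rep a.2.2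
  obtain ⟨Y, hY, hY0⟩ := (hR.matRel b.1).exists_nonneg_rep b.2.2
  have hε4 : 0 < ε / 4 := by positivity
  obtain ⟨σ, hσ, hd⟩ := exists_seq_dimension hrc hX hX0 hY hY0 hε4 (by
    rintro ⟨N, h2, h3, W, hW⟩
    have := hε' N h2 h3 W
    linarith)
  choose d hd hdle using hd
  choose τ hτ T hT hTd using hd
  obtain ⟨τ', hτ', T', hT', hu⟩ := exists_ultralimit_isMatrixExtension hR hσ.tendsto_atTop hT
    fun m => (hτ m).2.1
  -- In the limit, the functions of `b` vanishing near `0` have trace at most the rank of `a`.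
  have key : ∀ δ > 0, (T' b.1 (realCfc (fun x => ramp ((x - δ) / δ)) b.2.1)).re
      ≤ (T' a.1 (realCfc (fun x => ramp (x / (ε / 4))) a.2.1)).re := by
    intro δ hδ
    have h2 := hu b.1 _ _ ((hR.matRel b.1).cfc hY (fun j => (hY0 j).isSelfAdjoint)
      b.2.2.isSelfAdjoint (f := fun x => ramp ((x - δ) / δ)) (by fun_prop))
      (fun j => cfc_predicate _ _) (cfc_predicate _ _)
    have h3 := hu a.1 _ _ ((hR.matRel a.1).cfc hX (fun j => (hX0 j).isSelfAdjoint)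
      a.2.2.isSelfAdjoint (f := fun x => ramp (x / (ε / 4))) (by fun_prop))
      (fun j => cfc_predicate _ _) (cfc_predicate _ _)
    have h4 := h3.add ((tendsto_one_div_add_atTop_nhds_zero_nat (𝕜 := ℝ)).mono_left
      Nat.hyperfilter_le_atTop)
    rw [add_zero] at h4
    refine le_of_tendsto_of_tendsto h2 h4 (Nat.hyperfilter_le_atTop ?_)
    filter_upwards [(tendsto_one_div_add_atTop_nhds_zero_nat (𝕜 := ℝ)).eventually_lt_const hδ]
      with m hm
    have h5 := (hT m).isQuasitrace b.1 |>.re_le_dimension (hY0 (σ m)).isSelfAdjoint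
      (f := fun x => ramp ((x - δ) / δ)) (by fun_prop) (by fun_prop)
      (fun x => le_max_right _ _) hδ (fun x => ramp_mono (by
        gcongr
        exact (sub_le_sub_left hm.le x).trans (le_max_left _ _)))
      (hTd m (MInfPos.cutdown ⟨b.1, Y (σ m), hY0 _⟩ (1 / ((m : ℝ) + 1))))
    have h6 := (hT m).isQuasitrace a.1 |>.dimension_le_re (hX0 (σ m))
      (f := fun x => ramp (x / (ε / 4))) (by fun_prop) (by fun_prop)
      (fun x => le_max_right _ _) (fun x y h => by dsimp only; gcongr)
      (fun x => ramp_nonneg _) (fun x h => by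
        have h7 : ε / 4 ≤ x := by
          by_contra! h8
          rw [max_eq_right (by linarith)] at h
          exact lt_irrefl _ h
        exact (ramp_of_one_le ((one_le_div hε4).2 h7)).ge)
      (hTd m (MInfPos.cutdown ⟨a.1, X (σ m), hX0 _⟩ (ε / 4)))
    exact h5.trans ((hdle m).trans (by gcongr))
  choose d' hd' using fun c : MInfPos L => (hT'.isQuasitrace c.1).exists_dimension c.2.2
  have h2 := hab d' ⟨τ', hτ', T', hT', hd'⟩
  have h3 := (hT'.isQuasitrace b.1).dimension_le_of_forall b.2.2 key (hd' b)
  have h4 : cutdown a.2.1 0 = a.2.1 :=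
    sub_eq_zero.1 (norm_le_zero_iff.1 (norm_cutdown_sub_le a.2.2 le_rfl))
  have h5 := hd' a
  rw [← h4, cutdown] at h5
  have h6 := (hT'.isQuasitrace a.1).re_le_dimension a.2.2.isSelfAdjoint
    (f := fun x => ramp (x / (ε / 4))) (by fun_prop) (by fun_prop) (fun x => le_max_right _ _) hε4
    (fun x => ramp_mono (by gcongr; simp)) h5
  linarith

end Limit

end CuntzComparison

theorem mainTheorem7 {A : ℕ → Type*}
    [∀ i, CStarAlgebra (A i)] [∀ i, PartialOrder (A i)] [∀ i, StarOrderedRing (A i)]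
    {L : Type*} [CStarAlgebra L] [PartialOrder L] [StarOrderedRing L]
    (φ : ∀ i, A i →⋆ₐ[ℂ] A (i + 1)) (ψ : ∀ i, A i →⋆ₐ[ℂ] L)
    (hlim : CuntzComparison.IsInductiveLimit φ ψ)
    (hfin : ∀ i, CuntzComparison.IsStablyFinite (A i))
    (hsimple : CuntzComparison.IsSimple L)
    (hrc : Filter.liminf (fun i => CuntzComparison.rc (A i)) Filter.atTop = 0) :
    CuntzComparison.IsStablyFinite L ∧ CuntzComparison.HasStrictComparison L :=
  ⟨hlim.isStablyFinite hfin, hlim.hasStrictComparison hrc⟩
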